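/- Let $n\ge 3$. Let $W(B_n)$ be the group of signed permutations, that is of the bijections $w$ of $\{\pm1,\dots,\pm n\}$ with $w(-i)=-w(i)$ for all $i$, with the simple reflections $s_i=(i\;\,i{+}1)(-i\;\,-(i{+}1))$ for $1\le i<n$ and $s_n=(n\;\,-n)$. Let $T$ be the set of all conjugates of the simple reflections, let $\ell(w)$ be the least length of a word in $T$ with product $w$, and let $v\le w$ mean $\ell(w)=\ell(v)+\ell(v^{-1}w)$ (the absolute order). Let $c$ be a Coxeter element, that is a conjugate of a product of all the simple reflections $s_1,\dots,s_n$, each taken once, in some order, for instance the $2n$-cycle $c=(1\;2\cdots n\;\,{-1}\;{-2}\cdots{-n})$. Let $\mathrm{NC}(B_n)=\{w\in W(B_n): w\le c\}$, ordered by $\le$, and let $\mathrm{Aut}(\mathrm{NC}(B_n))$ be the group of its lattice automorphisms, that is of the bijections $\varphi$ of $\mathrm{NC}(B_n)$ onto itself such that $\varphi$ and $\varphi^{-1}$ preserve the order. A bipartition of $c$ is a factorization $c=lr$ in $W(B_n)$ with $l^2=r^2=1$. Then the following hold. 1. The element $c$ has a bipartition. For every bipartition $c=lr$, the maps $\varphi_l(w)=l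 w^{-1} l$ and $\varphi_r(w)=r w^{-1} r$ are lattice automorphisms of $\mathrm{NC}(B_n)$ and generate $\mathrm{Aut}(\mathrm{NC}(B_n))$. This group is isomorphic to the dihedral group of order $2n$ (the symmetry group of the regular $n$-gon), by an isomorphism that takes $\varphi_l$ and $\varphi_r$ to two reflections whose product is a rotation by $2\pi/n$. In particular $|\mathrm{Aut}(\mathrm{NC}(B_n))|=2n$. 2. The vertices of the regular $2n$-gon can be labelled bijectively by $\{\pm1,\dots,\pm n\}$ so that $c$ takes the label of each vertex to the label of the cyclically next vertex. For every such labelling, there is a surjective homomorphism $\rho$ from the symmetry group of the $2n$-gon (of order $4n$) onto $\mathrm{Aut}(\mathrm{NC}(B_n))$, whose kernel consists of the identity and the rotation by $180^\circ$, such that for every symmetry $g$ and every $w\in\mathrm{NC}(B_n)$ the partition of the vertices into the cycles of $\rho(g)(w)$ is the image under $g$ of the partition of the vertices into the cycles of $w$. -/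

import Mathlib

namespace TypeB

/-- The set `{±1, …, ±n}`: the pair `(i, ε)` stands for `ε · (i + 1)`. -/
abbrev SignedIndex (n : ℕ) : Type := Fin n × ℤˣ

/-- The sign change `x ↦ -x` on `{±1, …, ±n}`. -/
def flip {n : ℕ} (x : SignedIndex n) : SignedIndex n := (x.1, -x.2)

/-- The signed permutations: the bijections `w` of `{±1, …, ±n}` with `w (-x) = - w x`. -/
def signedPerms (n : ℕ) : Subgroup (Equiv.Perm (SignedIndex n)) where
  carrier := {w | ∀ x, w (flip x) = flip (w x)}
  mul_mem' := by
    intro a b ha hb x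
    rw [Equiv.Perm.mul_apply, Equiv.Perm.mul_apply, hb, ha]
  one_mem' := by
    intro x
    rfl
  inv_mem' := by
    intro a ha x
    rw [Equiv.Perm.inv_eq_iff_eq, ha, Equiv.Perm.coe_inv, Equiv.apply_symm_apply]

/-- The Coxeter group of type `B_n`, that is the signed symmetric group. -/
abbrev W (n : ℕ) : Type := ↥(signedPerms n)

/-- The paired transposition `((i j)) = (i j)(-i -j)` for positive `i`, `j`. -/
def pairedSwap {n : ℕ} (i j : Fin n) : W n :=
  ⟨Equiv.prodCongr (Equiv.swap i j) (Equiv.refl ℤˣ), fun _ => rfl⟩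

/-- The balanced transposition `[i] = (i -i)`. -/
def signSwap {n : ℕ} (i : Fin n) : W n :=
  ⟨Equiv.swap (i, 1) (i, -1), by
    rintro ⟨k, e⟩
    by_cases h : k = i
    · subst h
      rcases Int.units_eq_one_or e with rfl | rfl <;> simp [flip]
    · rw [Equiv.swap_apply_of_ne_of_ne (a := (i, 1)) (b := (i, -1)) (x := (k, e)) (by simp [h])
        (by simp [h]), Equiv.swap_apply_of_ne_of_ne (by simp [flip, h]) (by simp [flip, h])]⟩

/-- The simple reflections, indexed from `0`: `((1 2)), ((2 3)), …, ((n-1 n)), [n]`. -/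
def simple {n : ℕ} (i : Fin n) : W n :=
  if h : (i : ℕ) + 1 < n then pairedSwap i ⟨i + 1, h⟩ else signSwap i

/-- The reflections: the conjugates of the simple reflections. -/
def reflections (n : ℕ) : Set (W n) := {t | ∃ (w : W n) (i : Fin n), t = w * simple i * w⁻¹}

/-- The absolute length: the least length of a word in the reflections that represents `w`. -/
noncomputable def absLength {n : ℕ} (w : W n) : ℕ :=
  sInf {k | ∃ L : List (W n), (∀ t ∈ L, t ∈ reflections n) ∧ L.prod = w ∧ L.length = k}

/-- The absolute order on `W n`. -/
def AbsLE {n : ℕ} (v w : W n) : Prop := absLength w = absLength v + absLength (v⁻¹ * w)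

/-- A Coxeter element: a conjugate of a product of all simple reflections in some order. -/
def IsCoxeterElement {n : ℕ} (c : W n) : Prop :=
  ∃ (σ : Equiv.Perm (Fin n)) (g : W n),
    c = g * (List.ofFn fun i => simple (σ i)).prod * g⁻¹

/-- The non-crossing partitions `NC(B_n)` with respect to `c`: all `w ≤ c`. -/
def NC {n : ℕ} (c : W n) : Type := {w : W n // AbsLE w c}

/-- `NC c` carries the absolute order. -/
instance {n : ℕ} (c : W n) : LE (NC c) := ⟨fun v w => AbsLE v.1 w.1⟩

/-- `c = l r` is a bipartition of `c`. -/
def IsBipartition {n : ℕ} (c l r : W n) : Prop := c = l * r ∧ l ^ 2 = 1 ∧ r ^ 2 = 1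

/-- The symmetries of the regular `m`-gon acting on its vertices, which are numbered cyclically
by `ZMod m`: the rotations `k ↦ k + i` and the reflections `k ↦ -(k + i)`. -/
def polygonAct {m : ℕ} : DihedralGroup m → ZMod m → ZMod m
  | DihedralGroup.r i, k => k + i
  | DihedralGroup.sr i, k => -(k + i)

/-- A labelling of the vertices of the `2n`-gon by `{±1, …, ±n}` in the cyclic order given by `c`.
For `c = [1 … n]` the labels in cyclic order are `1, …, n, -1, …, -n`. -/
def IsPolygonLabelling {n : ℕ} (c : W n) (f : ZMod (2 * n) ≃ SignedIndex n) : Prop :=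
  ∀ k, f (k + 1) = c.1 (f k)

/-- The vertices `x` and `y` of the `2n`-gon lie in the same block of the picture of `w`: the
blocks of `w` are the (possibly trivial) cycles of the permutation `w`. -/
def SameBlock {n : ℕ} (f : ZMod (2 * n) ≃ SignedIndex n) (w : W n) (x y : ZMod (2 * n)) : Prop :=
  w.1.SameCycle (f x) (f y)

end TypeB

/-! Letting `W n` act on `ℝⁿ` turns the absolute order into linear algebra: the length of `w` is the
dimension of the range of `w - 1` (`absLength_eq`), and an element below `c` is determined by this
moved space (`OrthLE.eq_of_movSpace_eq`). A Coxeter element is a single `2n`-cycle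
(`sameCycle_of_isCoxeterElement`), so the vectors `± e_i` sit at the vertices of a `2n`-gon which
`c` rotates by one step, opposite vertices carrying opposite vectors. Since `c` has no nonzero fixed
vector, every reflection lies below `c`. The reflections are the atoms: chords of the polygon up to
the half turn, with root `vec f k - vec f l`.

Polygon symmetries act on `NC c` (`polygonAut`): rotations commute with `c` and act by conjugation;
reflections invert `c` and act by inversion followed by conjugation. The half turn is the central
element `-1` and acts trivially.

The substance is that there are no other automorphisms (`polygonAut_surjective`). Automorphisms
preserve rank. The edges of the polygon are exactly the atoms that have a rank-two upper bound with
every atom (`exists_upper_bound_edge`, `exists_eq_edge`), so automorphisms permute them. Distinct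
edges with a rank-two upper bound above a third atom are adjacent (`edge_adjacent`), so this
permutation is a rotation or a reflection (`apply_edge_classification`). After composing with a
polygon symmetry all edges are fixed; then all chords are, by induction on their length and a
separate argument for diameters, and everything is, because roots span each moved space
(`eq_one_of_fix_edges`).

The kernel of the action is generated by the half turn, as is that of the quotient map from the
symmetries of the `2n`-gon to those of the `n`-gon; this identifies the automorphism group. In a
bipartition `c = l r` the factor `l` inverts `c`, hence is a polygon reflection, and `r` is the
neighbouring one. -/

namespace TypeB

open Module

/-! ### Moved spaces and the absolute order on the orthogonal group. -/

section OrthogonalGroup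

variable {V : Type*} [NormedAddCommGroup V] [InnerProductSpace ℝ V]

/-- The linear map `A - 1`. -/
def subOne (A : V ≃ₗᵢ[ℝ] V) : V →ₗ[ℝ] V := A.toLinearEquiv.toLinearMap - LinearMap.id

/-- The fixed space of `A`. -/
def fixSpace (A : V ≃ₗᵢ[ℝ] V) : Submodule ℝ V := LinearMap.ker (subOne A)

/-- The moved space of `A`, that is the range of `A - 1`. -/
def movSpace (A : V ≃ₗᵢ[ℝ] V) : Submodule ℝ V := LinearMap.range (subOne A)

/-- The dimension of the moved space. -/
noncomputable def movRank (A : V ≃ₗᵢ[ℝ] V) : ℕ := finrank ℝ (movSpace A)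

/-- The orthogonal reflection with root `a`. -/
noncomputable def rootReflection (a : V) : V ≃ₗᵢ[ℝ] V := (ℝ ∙ a)ᗮ.reflection

theorem orth_mul_apply (A B : V ≃ₗᵢ[ℝ] V) (v : V) : (A * B) v = A (B v) := rfl

theorem orth_apply_inv (A : V ≃ₗᵢ[ℝ] V) (v : V) : A (A⁻¹ v) = v := A.apply_symm_apply v

theorem orth_inv_apply (A : V ≃ₗᵢ[ℝ] V) (v : V) : A⁻¹ (A v) = v := A.symm_apply_apply v

theorem mem_fixSpace {A : V ≃ₗᵢ[ℝ] V} {v : V} : v ∈ fixSpace A ↔ A v = v := by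
  simp [fixSpace, subOne, sub_eq_zero]

theorem mem_movSpace {A : V ≃ₗᵢ[ℝ] V} {v : V} : v ∈ movSpace A ↔ ∃ u, A u - u = v := by
  simp [movSpace, subOne]

theorem sub_mem_movSpace (A : V ≃ₗᵢ[ℝ] V) (v : V) : A v - v ∈ movSpace A :=
  mem_movSpace.2 ⟨v, rfl⟩

theorem movSpace_mul_le (A B : V ≃ₗᵢ[ℝ] V) : movSpace (A * B) ≤ movSpace A ⊔ movSpace B := by
  intro v hv
  obtain ⟨u, rfl⟩ := mem_movSpace.1 hv
  have : (A * B) u - u = (A (B u) - B u) + (B u - u) := by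
    rw [orth_mul_apply]; abel
  rw [this]
  exact Submodule.add_mem_sup (sub_mem_movSpace A _) (sub_mem_movSpace B _)

theorem movSpace_inv (A : V ≃ₗᵢ[ℝ] V) : movSpace A⁻¹ = movSpace A := by
  have key : ∀ B : V ≃ₗᵢ[ℝ] V, movSpace B⁻¹ ≤ movSpace B := by
    intro B v hv
    obtain ⟨u, rfl⟩ := mem_movSpace.1 hv
    have : B⁻¹ u - u = -(B (B⁻¹ u) - B⁻¹ u) := by
      rw [orth_apply_inv]
      simp
    rw [this]
    exact neg_mem (sub_mem_movSpace B _)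
  refine le_antisymm (key A) ?_
  simpa using key A⁻¹

theorem movRank_inv (A : V ≃ₗᵢ[ℝ] V) : movRank A⁻¹ = movRank A := by
  rw [movRank, movRank, movSpace_inv]

theorem movSpace_conj (A B : V ≃ₗᵢ[ℝ] V) :
    movSpace (B * A * B⁻¹) = (movSpace A).map B.toLinearEquiv.toLinearMap := by
  ext v
  simp only [Submodule.mem_map, mem_movSpace]
  constructor
  · rintro ⟨u, rfl⟩
    refine ⟨_, ⟨B⁻¹ u, rfl⟩, ?_⟩
    simp [orth_mul_apply]
  · rintro ⟨_, ⟨u, rfl⟩, rfl⟩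
    refine ⟨B u, ?_⟩
    simp [orth_mul_apply, orth_inv_apply]

theorem movRank_conj (A B : V ≃ₗᵢ[ℝ] V) : movRank (B * A * B⁻¹) = movRank A := by
  rw [movRank, movSpace_conj]
  exact LinearEquiv.finrank_map_eq B.toLinearEquiv _

theorem movSpace_one : movSpace (1 : V ≃ₗᵢ[ℝ] V) = ⊥ := by
  rw [eq_bot_iff]
  intro v hv
  obtain ⟨u, rfl⟩ := mem_movSpace.1 hv
  simp

theorem movRank_one : movRank (1 : V ≃ₗᵢ[ℝ] V) = 0 := by
  rw [movRank, movSpace_one, finrank_bot]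

theorem rootReflection_self (a : V) : rootReflection a a = -a :=
  Submodule.reflection_orthogonalComplement_singleton_eq_neg a

theorem rootReflection_of_inner_eq_zero {a v : V} (h : inner ℝ a v = 0) :
    rootReflection a v = v :=
  Submodule.reflection_mem_subspace_eq_self (Submodule.mem_orthogonal_singleton_iff_inner_right.2 h)

theorem rootReflection_apply_sub_mem (a v : V) : rootReflection a v - v ∈ ℝ ∙ a := by
  have h := Submodule.reflection_singleton_apply (𝕜 := ℝ) a v
  rw [rootReflection, Submodule.reflection_orthogonal_apply, h]
  have : ∀ x : V, -(x - v) - v = -x := fun x => by abel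
  rw [this]
  exact neg_mem (nsmul_mem (Submodule.smul_mem _ _ (Submodule.mem_span_singleton_self a)) 2)

theorem rootReflection_mul_self (a : V) : rootReflection a * rootReflection a = 1 := by
  rw [rootReflection]
  exact Submodule.reflection_mul_reflection (ℝ ∙ a)ᗮ

theorem rootReflection_inv (a : V) : (rootReflection a)⁻¹ = rootReflection a :=
  inv_eq_of_mul_eq_one_left (rootReflection_mul_self a)

theorem movSpace_rootReflection (a : V) : movSpace (rootReflection a) = ℝ ∙ a := by
  apply le_antisymm
  · intro v hv
    obtain ⟨u, rfl⟩ := mem_movSpace.1 hv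
    exact rootReflection_apply_sub_mem a u
  · rw [Submodule.span_singleton_le_iff_mem]
    have h := sub_mem_movSpace (rootReflection a) a
    rw [rootReflection_self] at h
    have h2 := (movSpace (rootReflection a)).smul_mem (-(1 / 2 : ℝ)) h
    convert h2 using 1
    module

theorem movRank_rootReflection {a : V} (ha : a ≠ 0) : movRank (rootReflection a) = 1 := by
  rw [movRank, movSpace_rootReflection, finrank_span_singleton ha]

theorem rootReflection_conj (A : V ≃ₗᵢ[ℝ] V) (a : V) :
    A * rootReflection a * A⁻¹ = rootReflection (A a) := by
  ext v
  obtain ⟨u, rfl⟩ := A.surjective v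
  have h := fun x y => Submodule.reflection_singleton_apply (𝕜 := ℝ) (E := V) x y
  rw [orth_mul_apply, orth_mul_apply, orth_inv_apply]
  simp only [rootReflection, Submodule.reflection_orthogonal_apply, h, map_neg, map_sub, map_smul,
    LinearIsometryEquiv.inner_map_map, LinearIsometryEquiv.norm_map, map_nsmul]

theorem inner_eq_zero_of_mem {A : V ≃ₗᵢ[ℝ] V} {u v : V} (hu : u ∈ fixSpace A)
    (hv : v ∈ movSpace A) : inner ℝ u v = 0 := by
  obtain ⟨x, rfl⟩ := mem_movSpace.1 hv
  have h := A.inner_map_map u x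
  rw [mem_fixSpace.1 hu] at h
  rw [inner_sub_right, h, sub_self]

theorem orth_mem_fixSpace_inv_mul {A C : V ≃ₗᵢ[ℝ] V} {v : V} :
    v ∈ fixSpace (A⁻¹ * C) ↔ A v = C v := by
  rw [mem_fixSpace, orth_mul_apply]
  constructor
  · intro h
    rw [← orth_apply_inv A (C v), h]
  · intro h
    rw [← h, orth_inv_apply]

variable [FiniteDimensional ℝ V]

theorem finrank_fixSpace_add_movRank (A : V ≃ₗᵢ[ℝ] V) :
    finrank ℝ (fixSpace A) + movRank A = finrank ℝ V := by
  rw [add_comm]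
  exact LinearMap.finrank_range_add_finrank_ker (subOne A)

theorem movSpace_eq_orthogonal (A : V ≃ₗᵢ[ℝ] V) : movSpace A = (fixSpace A)ᗮ := by
  apply Submodule.eq_of_le_of_finrank_eq
  · intro v hv
    rw [Submodule.mem_orthogonal]
    exact fun u hu => inner_eq_zero_of_mem hu hv
  · have h1 := finrank_fixSpace_add_movRank A
    have h2 := Submodule.finrank_add_finrank_orthogonal (fixSpace A)
    rw [movRank] at h1
    omega

theorem movRank_mul_le (A B : V ≃ₗᵢ[ℝ] V) : movRank (A * B) ≤ movRank A + movRank B :=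
  (Submodule.finrank_mono (movSpace_mul_le A B)).trans
    (Submodule.finrank_add_le_finrank_add_finrank _ _)

theorem eq_one_of_movRank_eq_zero {A : V ≃ₗᵢ[ℝ] V} (h : movRank A = 0) : A = 1 := by
  ext v
  rw [movRank, Submodule.finrank_eq_zero] at h
  have := sub_mem_movSpace A v
  rw [h, Submodule.mem_bot, sub_eq_zero] at this
  exact this

/-- The absolute order on the orthogonal group. -/
def OrthLE (A B : V ≃ₗᵢ[ℝ] V) : Prop := movRank B = movRank A + movRank (A⁻¹ * B)

theorem OrthLE.movSpace_eq_sup {A B : V ≃ₗᵢ[ℝ] V} (h : OrthLE A B) :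
    movSpace B = movSpace A ⊔ movSpace (A⁻¹ * B) := by
  apply Submodule.eq_of_le_of_finrank_le
  · simpa using movSpace_mul_le A (A⁻¹ * B)
  · exact (Submodule.finrank_add_le_finrank_add_finrank _ _).trans h.ge

theorem OrthLE.movSpace_le {A B : V ≃ₗᵢ[ℝ] V} (h : OrthLE A B) : movSpace A ≤ movSpace B := by
  rw [h.movSpace_eq_sup]
  exact le_sup_left

/-- Write `a = A u - u`. Since `A u` and `u` have equal norm, the reflection swaps them, so the
product fixes `u` as well as all of `fixSpace A`, which is orthogonal to `a`. Subadditivity prevents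
a drop by more than one. -/
theorem movRank_rootReflection_mul_add_one {A : V ≃ₗᵢ[ℝ] V} {a : V} (ha : a ≠ 0)
    (h : a ∈ movSpace A) : movRank (rootReflection a * A) + 1 = movRank A := by
  have h1 : movRank A ≤ 1 + movRank (rootReflection a * A) := by
    have := movRank_mul_le (rootReflection a) (rootReflection a * A)
    rwa [← mul_assoc, rootReflection_mul_self, one_mul, movRank_rootReflection ha] at this
  have h2 : fixSpace A < fixSpace (rootReflection a * A) := by
    rw [SetLike.lt_iff_le_and_exists]
    refine ⟨fun v hv => ?_, ?_⟩
    · rw [mem_fixSpace, orth_mul_apply, mem_fixSpace.1 hv]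
      apply rootReflection_of_inner_eq_zero
      rw [real_inner_comm]
      exact inner_eq_zero_of_mem hv h
    · obtain ⟨u, hu⟩ := mem_movSpace.1 h
      refine ⟨u, ?_, ?_⟩
      · rw [mem_fixSpace, orth_mul_apply, ← hu]
        exact Submodule.reflection_sub (A.norm_map u)
      · rw [mem_fixSpace]
        intro h0
        rw [h0, sub_self] at hu
        exact ha hu.symm
  have h3 := Submodule.finrank_lt_finrank_of_lt h2
  have h4 := finrank_fixSpace_add_movRank A
  have h5 := finrank_fixSpace_add_movRank (rootReflection a * A)
  omega

theorem rootReflection_orthLE_iff {A : V ≃ₗᵢ[ℝ] V} {a : V} (ha : a ≠ 0) :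
    OrthLE (rootReflection a) A ↔ a ∈ movSpace A := by
  constructor
  · intro h
    apply h.movSpace_le
    rw [movSpace_rootReflection]
    exact Submodule.mem_span_singleton_self a
  · intro h
    rw [OrthLE, movRank_rootReflection ha, rootReflection_inv,
      ← movRank_rootReflection_mul_add_one ha h, add_comm]

/-- If `A x = C x`, then `C x - x = A x - x` is moved by `A`; this is one inclusion. The preimage
has dimension at most `movRank A` plus that of `fixSpace C`, which under `A ≤ C` is exactly the
dimension of the left side. -/
theorem OrthLE.fixSpace_inv_mul {A C : V ≃ₗᵢ[ℝ] V} (h : OrthLE A C) :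
    fixSpace (A⁻¹ * C) = (movSpace A).comap (subOne C) := by
  have hle : fixSpace (A⁻¹ * C) ≤ (movSpace A).comap (subOne C) := by
    intro x hx
    have : subOne C x = A x - x := by rw [orth_mem_fixSpace_inv_mul.1 hx]; rfl
    rw [Submodule.mem_comap, this]
    exact sub_mem_movSpace A x
  apply Submodule.eq_of_le_of_finrank_le hle
  set K := (movSpace A).comap (subOne C)
  have h1 := LinearMap.finrank_range_add_finrank_ker ((subOne C).domRestrict K)
  have h2 : finrank ℝ (LinearMap.range ((subOne C).domRestrict K)) ≤ movRank A := by
    apply Submodule.finrank_mono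
    rintro _ ⟨x, rfl⟩
    exact x.2
  have h3 : finrank ℝ (LinearMap.ker ((subOne C).domRestrict K)) ≤ finrank ℝ (fixSpace C) := by
    rw [← Submodule.finrank_map_subtype_eq]
    apply Submodule.finrank_mono
    rintro _ ⟨x, hx, rfl⟩
    exact hx
  have h4 := finrank_fixSpace_add_movRank C
  have h5 := finrank_fixSpace_add_movRank (A⁻¹ * C)
  unfold OrthLE at h
  omega

/-- If `A ≤ C`, then `A` and `C` agree on every vector that `C - 1` maps into the moved space
of `A`. -/
theorem OrthLE.apply_eq_of_sub_mem {A C : V ≃ₗᵢ[ℝ] V} (h : OrthLE A C) {v : V}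
    (hv : C v - v ∈ movSpace A) : A v = C v := by
  rw [← orth_mem_fixSpace_inv_mul, h.fixSpace_inv_mul]
  exact hv

/-- An element below `C` is determined by its moved space. -/
theorem OrthLE.eq_of_movSpace_eq {A B C : V ≃ₗᵢ[ℝ] V} (hA : OrthLE A C) (hB : OrthLE B C)
    (h : movSpace A = movSpace B) : A = B := by
  have hfix : fixSpace A = fixSpace B := by
    rw [← Submodule.orthogonal_orthogonal (fixSpace A), ← movSpace_eq_orthogonal, h,
      movSpace_eq_orthogonal, Submodule.orthogonal_orthogonal]
  -- The space is the sum of the vectors on which `A` agrees with `C` and the vectors fixed by `A`.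
  -- Both pieces depend only on the moved space, so `B` agrees with `A` on each.
  have hinf : fixSpace (A⁻¹ * C) ⊓ fixSpace A ≤ fixSpace C := by
    rintro x ⟨h1, h2⟩
    rw [mem_fixSpace, ← orth_mem_fixSpace_inv_mul.1 h1, mem_fixSpace.1 h2]
  have hsup : fixSpace (A⁻¹ * C) ⊔ fixSpace A = ⊤ := by
    apply Submodule.eq_top_of_finrank_eq
    have h1 := Submodule.finrank_sup_add_finrank_inf_eq (fixSpace (A⁻¹ * C)) (fixSpace A)
    have h2 := Submodule.finrank_mono hinf
    have h3 := finrank_fixSpace_add_movRank C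
    have h4 := finrank_fixSpace_add_movRank (A⁻¹ * C)
    have h5 := finrank_fixSpace_add_movRank A
    have h6 := Submodule.finrank_le (fixSpace (A⁻¹ * C) ⊔ fixSpace A)
    unfold OrthLE at hA
    omega
  ext v
  have hv : v ∈ fixSpace (A⁻¹ * C) ⊔ fixSpace A := hsup ▸ Submodule.mem_top
  obtain ⟨x, hx, y, hy, rfl⟩ := Submodule.mem_sup.1 hv
  have hx' : B x = C x := by
    apply hB.apply_eq_of_sub_mem
    rw [← h]
    rw [hA.fixSpace_inv_mul] at hx
    exact hx
  rw [map_add, map_add, orth_mem_fixSpace_inv_mul.1 hx, hx', mem_fixSpace.1 hy]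
  rw [hfix] at hy
  rw [mem_fixSpace.1 hy]

theorem OrthLE.eq_of_movRank_le {A B : V ≃ₗᵢ[ℝ] V} (h : OrthLE A B)
    (h' : movRank B ≤ movRank A) : A = B := by
  have h0 : movRank (A⁻¹ * B) = 0 := by unfold OrthLE at h; omega
  exact inv_mul_eq_one.1 (eq_one_of_movRank_eq_zero h0)

theorem OrthLE.trans {A B C : V ≃ₗᵢ[ℝ] V} (hAB : OrthLE A B) (hBC : OrthLE B C) :
    OrthLE A C := by
  have h1 := movRank_mul_le A (A⁻¹ * C)
  have h2 := movRank_mul_le (A⁻¹ * B) (B⁻¹ * C)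
  rw [mul_inv_cancel_left] at h1
  rw [mul_assoc, mul_inv_cancel_left] at h2
  unfold OrthLE at *
  omega

theorem movRank_mul_rootReflection_add_one {A : V ≃ₗᵢ[ℝ] V} {a : V} (ha : a ≠ 0)
    (h : a ∈ movSpace A) : movRank (A * rootReflection a) + 1 = movRank A := by
  rw [← movSpace_inv] at h
  rw [← movRank_inv A, ← movRank_rootReflection_mul_add_one ha h, ← movRank_inv, mul_inv_rev,
    rootReflection_inv]

end OrthogonalGroup

end TypeB

/-! ### The reflection representation and the absolute length. -/

namespace TypeB

open Module

variable {n : ℕ}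

theorem flip_flip (x : SignedIndex n) : flip (flip x) = x := by simp [flip]

theorem flip_ne (x : SignedIndex n) : flip x ≠ x := by
  intro h
  have := congrArg Prod.snd h
  rcases Int.units_eq_one_or x.2 with h' | h' <;> simp [flip, h'] at this

theorem apply_flip (w : W n) (x : SignedIndex n) : w.1 (flip x) = flip (w.1 x) := w.2 x

theorem fst_eq_iff {x y : SignedIndex n} : x.1 = y.1 ↔ x = y ∨ x = flip y := by
  constructor
  · intro h
    rcases Int.units_eq_one_or x.2 with hx | hx <;> rcases Int.units_eq_one_or y.2 with hy | hy <;>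
      simp [flip, Prod.ext_iff, h, hx, hy]
  · rintro (rfl | rfl) <;> rfl

/-- The signed coordinate vector `± e_i`. -/
noncomputable def signedVec (x : SignedIndex n) : EuclideanSpace ℝ (Fin n) :=
  ((x.2 : ℤ) : ℝ) • EuclideanSpace.basisFun (Fin n) ℝ x.1

theorem signedVec_flip (x : SignedIndex n) : signedVec (flip x) = -signedVec x := by
  simp [signedVec, flip]

theorem inner_signedVec_self (x : SignedIndex n) : inner ℝ (signedVec x) (signedVec x) = 1 := by
  rcases Int.units_eq_one_or x.2 with h | h <;> simp [signedVec, h]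

theorem inner_signedVec_of_ne {x y : SignedIndex n} (h : x ≠ y) (h' : x ≠ flip y) :
    inner ℝ (signedVec x) (signedVec y) = 0 := by
  have h1 : x.1 ≠ y.1 := fun h2 => (fst_eq_iff.1 h2).elim h h'
  rw [signedVec, signedVec, inner_smul_left, inner_smul_right,
    (EuclideanSpace.basisFun (Fin n) ℝ).orthonormal.2 h1, mul_zero, mul_zero]

theorem signedVec_injective : Function.Injective (signedVec (n := n)) := by
  intro x y h
  by_contra hne
  by_cases h' : x = flip y
  · have h1 := inner_signedVec_self y
    rw [h', signedVec_flip] at h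
    have h2 : inner ℝ (-signedVec y) (signedVec y) = -1 := by rw [inner_neg_left, h1]
    rw [h, h1] at h2
    norm_num at h2
  · have h1 := inner_signedVec_of_ne hne h'
    rw [h, inner_signedVec_self] at h1
    exact one_ne_zero h1

theorem orthonormal_signedVec (w : W n) :
    Orthonormal ℝ fun i : Fin n => signedVec (w.1 (i, 1)) := by
  rw [orthonormal_iff_ite]
  intro i j
  split_ifs with h
  · rw [h, inner_signedVec_self]
  · apply inner_signedVec_of_ne
    · intro heq
      exact h (congrArg Prod.fst (w.1.injective heq))
    · rw [← apply_flip]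
      intro heq
      exact h (congrArg Prod.fst (w.1.injective heq))

/-- The image of the standard basis under a signed permutation. -/
noncomputable def signedBasis (w : W n) : OrthonormalBasis (Fin n) ℝ (EuclideanSpace ℝ (Fin n)) :=
  OrthonormalBasis.mk (orthonormal_signedVec w)
    ((orthonormal_signedVec w).linearIndependent.span_eq_top_of_card_eq_finrank' (by simp)).ge

/-- The isometry of `ℝⁿ` that permutes the signed coordinate vectors as `w` does. -/
noncomputable def toIsometry (w : W n) :
    EuclideanSpace ℝ (Fin n) ≃ₗᵢ[ℝ] EuclideanSpace ℝ (Fin n) :=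
  (EuclideanSpace.basisFun (Fin n) ℝ).equiv (signedBasis w) (Equiv.refl _)

theorem toIsometry_signedVec (w : W n) (x : SignedIndex n) :
    toIsometry w (signedVec x) = signedVec (w.1 x) := by
  have h1 : ∀ i : Fin n, toIsometry w (signedVec (i, 1)) = signedVec (w.1 (i, 1)) := by
    intro i
    have : signedVec (i, (1 : ℤˣ)) = EuclideanSpace.basisFun (Fin n) ℝ i := by simp [signedVec]
    rw [this, toIsometry, OrthonormalBasis.equiv_apply_basis]
    simp [signedBasis]
  obtain ⟨i, e⟩ := x
  rcases Int.units_eq_one_or e with rfl | rfl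
  · exact h1 i
  · have : ((i, -1) : SignedIndex n) = flip (i, 1) := rfl
    rw [this, apply_flip, signedVec_flip, signedVec_flip, map_neg, h1]

theorem isometry_ext {A B : EuclideanSpace ℝ (Fin n) ≃ₗᵢ[ℝ] EuclideanSpace ℝ (Fin n)}
    (h : ∀ x, A (signedVec x) = B (signedVec x)) : A = B := by
  apply LinearIsometryEquiv.toLinearEquiv_injective
  apply (EuclideanSpace.basisFun (Fin n) ℝ).toBasis.ext'
  intro i
  have := h (i, 1)
  simpa [signedVec] using this

/-- The reflection representation of `W n`. -/
noncomputable def rep : W n →* (EuclideanSpace ℝ (Fin n) ≃ₗᵢ[ℝ] EuclideanSpace ℝ (Fin n)) where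
  toFun := toIsometry
  map_one' := isometry_ext fun x => toIsometry_signedVec 1 x
  map_mul' v w := isometry_ext fun x => by
    rw [orth_mul_apply, toIsometry_signedVec, toIsometry_signedVec, toIsometry_signedVec]
    rfl

theorem rep_signedVec (w : W n) (x : SignedIndex n) :
    rep w (signedVec x) = signedVec (w.1 x) := toIsometry_signedVec w x

theorem rep_injective : Function.Injective (rep (n := n)) := by
  intro v w h
  apply Subtype.ext
  apply Equiv.ext
  intro x
  apply signedVec_injective
  rw [← rep_signedVec, ← rep_signedVec, h]

theorem signedVec_sub_ne_zero {x y : SignedIndex n} (h : x ≠ y) :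
    signedVec x - signedVec y ≠ 0 := fun h' => h (signedVec_injective (sub_eq_zero.1 h'))

/-- The case `y = flip x` is allowed: the root is then twice a signed basis vector. Hence both kinds
of reflections have roots of the form `signedVec x - signedVec y`. -/
theorem rep_eq_rootReflection {w : W n} {x y : SignedIndex n}
    (hxy : w.1 x = y) (hyx : w.1 y = x)
    (h : ∀ z, z ≠ x → z ≠ y → z ≠ flip x → z ≠ flip y → w.1 z = z) :
    rep w = rootReflection (signedVec x - signedVec y) := by
  have key : rootReflection (signedVec x - signedVec y) (signedVec x) = signedVec y := by
    apply Submodule.reflection_sub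
    rw [← sq_eq_sq₀ (norm_nonneg _) (norm_nonneg _), ← real_inner_self_eq_norm_sq,
      ← real_inner_self_eq_norm_sq, inner_signedVec_self, inner_signedVec_self]
  have key' : rootReflection (signedVec x - signedVec y) (signedVec y) = signedVec x := by
    have := congrArg (rootReflection (signedVec x - signedVec y)) key
    rw [← this, ← orth_mul_apply, rootReflection_mul_self]
    rfl
  apply isometry_ext
  intro z
  rw [rep_signedVec]
  by_cases h1 : z = x
  · rw [h1, hxy, key]
  by_cases h2 : z = y
  · rw [h2, hyx, key']
  by_cases h3 : z = flip x
  · rw [h3, apply_flip, hxy, signedVec_flip, signedVec_flip, map_neg, key]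
  by_cases h4 : z = flip y
  · rw [h4, apply_flip, hyx, signedVec_flip, signedVec_flip, map_neg, key']
  rw [h z h1 h2 h3 h4, rootReflection_of_inner_eq_zero]
  have e1 : x ≠ flip z := fun h => h3 (by rw [h, flip_flip])
  have e2 : y ≠ flip z := fun h => h4 (by rw [h, flip_flip])
  rw [inner_sub_left, inner_signedVec_of_ne (Ne.symm h1) e1, inner_signedVec_of_ne (Ne.symm h2) e2,
    sub_self]

theorem rep_simple_of_lt {i : Fin n} (h : (i : ℕ) + 1 < n) : rep (simple i) =
    rootReflection (signedVec (i, 1) - signedVec (⟨i + 1, h⟩, 1)) := by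
  rw [simple, dif_pos h]
  apply rep_eq_rootReflection
  · simp [pairedSwap]
  · simp [pairedSwap]
  · intro z h1 h2 h3 h4
    have h5 : z.1 ≠ i := fun h' => ((fst_eq_iff (y := (i, 1))).1 h').elim h1 h3
    have h6 : z.1 ≠ ⟨i + 1, h⟩ :=
      fun h' => ((fst_eq_iff (y := (⟨i + 1, h⟩, 1))).1 h').elim h2 h4
    apply Prod.ext
    · exact Equiv.swap_apply_of_ne_of_ne h5 h6
    · rfl

theorem rep_simple_of_not_lt {i : Fin n} (h : ¬(i : ℕ) + 1 < n) : rep (simple i) =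
    rootReflection (signedVec (i, 1) - signedVec (i, -1)) := by
  rw [simple, dif_neg h]
  apply rep_eq_rootReflection
  · simp [signSwap]
  · simp [signSwap]
  · intro z h1 h2 h3 h4
    exact Equiv.swap_apply_of_ne_of_ne h1 h2

theorem rep_of_mem_reflections {t : W n} (ht : t ∈ reflections n) : ∃ x y : SignedIndex n,
    x ≠ y ∧ rep t = rootReflection (signedVec x - signedVec y) := by
  obtain ⟨w, i, rfl⟩ := ht
  obtain ⟨x, y, hxy, h⟩ : ∃ x y : SignedIndex n, x ≠ y ∧
      rep (simple i) = rootReflection (signedVec x - signedVec y) := by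
    by_cases h : (i : ℕ) + 1 < n
    · exact ⟨_, _, by simp [Fin.ext_iff], rep_simple_of_lt h⟩
    · exact ⟨_, _, by simp, rep_simple_of_not_lt h⟩
  refine ⟨w.1 x, w.1 y, fun h' => hxy (w.1.injective h'), ?_⟩
  rw [map_mul, map_mul, map_inv, h, rootReflection_conj, map_sub, rep_signedVec, rep_signedVec]

/-- The signed permutation with a given underlying permutation and given signs. -/
def ofPermSigns (σ : Equiv.Perm (Fin n)) (η : Fin n → ℤˣ) : W n :=
  ⟨{ toFun := fun x => (σ x.1, η x.1 * x.2)
     invFun := fun x => (σ.symm x.1, (η (σ.symm x.1))⁻¹ * x.2)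
     left_inv := fun x => by
       simp only [Equiv.symm_apply_apply, inv_mul_cancel_left]
     right_inv := fun x => by
       simp only [Equiv.apply_symm_apply, mul_inv_cancel_left] }, fun x => by simp [flip]⟩

/-- Signed permutations act transitively on pairs of opposite indices and on pairs lying over
different coordinates. The first kind is conjugated from the last simple reflection, the second from
the first one. -/
theorem exists_reflection {x y : SignedIndex n} (hxy : x ≠ y) :
    ∃ t ∈ reflections n, rep t = rootReflection (signedVec x - signedVec y) := by
  suffices h : ∃ (w : W n) (i : Fin n) (x' y' : SignedIndex n), w.1 x' = x ∧ w.1 y' = y ∧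
      rep (simple i) = rootReflection (signedVec x' - signedVec y') by
    obtain ⟨w, i, x', y', rfl, rfl, h⟩ := h
    refine ⟨w * simple i * w⁻¹, ⟨w, i, rfl⟩, ?_⟩
    rw [map_mul, map_mul, map_inv, h, rootReflection_conj, map_sub, rep_signedVec, rep_signedVec]
  have hpos : 0 < n := x.1.pos
  by_cases hfst : x.1 = y.1
  · have hy : y = flip x := by
      rcases fst_eq_iff.1 hfst with h | h
      · exact absurd h hxy
      · rw [h, flip_flip]
    let i : Fin n := ⟨n - 1, by omega⟩
    refine ⟨ofPermSigns (Equiv.swap i x.1) (fun _ => x.2), i, (i, 1), (i, -1), ?_, ?_,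
      rep_simple_of_not_lt (by simp only [i]; omega)⟩
    · simp [ofPermSigns]
    · simp [ofPermSigns, hy, flip]
  · have h1 : 1 < n := by
      by_contra hlt
      have hx := x.1.isLt
      have hy := y.1.isLt
      exact hfst (Fin.ext (by omega))
    let i : Fin n := ⟨0, hpos⟩
    let j : Fin n := ⟨0 + 1, h1⟩
    have hij : j ≠ i := by simp [i, j]
    have hx : Equiv.swap i x.1 i = x.1 := Equiv.swap_apply_left _ _
    have hx' : x.1 ≠ Equiv.swap i x.1 j :=
      fun h => hij.symm ((Equiv.swap i x.1).injective (hx.trans h))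
    refine ⟨ofPermSigns (Equiv.swap (Equiv.swap i x.1 j) y.1 * Equiv.swap i x.1)
      (fun k => if k = i then x.2 else y.2), i, (i, 1), (j, 1), ?_, ?_, rep_simple_of_lt h1⟩
    · simp [ofPermSigns, Equiv.swap_apply_of_ne_of_ne hx' hfst]
    · simp [ofPermSigns, hij]

/-- Subadditivity of the rank bounds every word from below. Conversely, if `w` moves `x`, then
`signedVec (w x) - signedVec x` is a root in the moved space, and multiplying by its reflection
lowers the rank by one. -/
theorem absLength_eq (w : W n) : absLength w = movRank (rep w) := by
  have lower : ∀ L : List (W n), (∀ t ∈ L, t ∈ reflections n) →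
      movRank (rep L.prod) ≤ L.length := by
    intro L
    induction L with
    | nil => intro _; simp [movRank_one]
    | cons t L ih =>
      intro h
      rw [List.prod_cons, map_mul, List.length_cons, add_comm]
      refine (movRank_mul_le _ _).trans (add_le_add ?_ (ih fun s hs => h s (by simp [hs])))
      obtain ⟨x, y, hxy, ht⟩ := rep_of_mem_reflections (h t (by simp))
      rw [ht, movRank_rootReflection (signedVec_sub_ne_zero hxy)]
  have upper : ∀ (k : ℕ) (w : W n), movRank (rep w) = k →
      ∃ L : List (W n), (∀ t ∈ L, t ∈ reflections n) ∧ L.prod = w ∧ L.length = k := by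
    intro k
    induction k with
    | zero =>
      intro w hw
      have : w = 1 := rep_injective (by rw [eq_one_of_movRank_eq_zero hw, map_one])
      exact ⟨[], by simp, by simp [this], rfl⟩
    | succ k ih =>
      intro w hw
      have hne : ∃ x, w.1 x ≠ x := by
        by_contra! hall
        have : w = 1 := Subtype.ext (Equiv.ext hall)
        rw [this, map_one, movRank_one] at hw
        omega
      obtain ⟨x, hx⟩ := hne
      obtain ⟨t, ht, htr⟩ := exists_reflection hx
      have hmem : signedVec (w.1 x) - signedVec x ∈ movSpace (rep w) := by
        rw [← rep_signedVec]
        exact sub_mem_movSpace _ _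
      have h1 := movRank_rootReflection_mul_add_one (signedVec_sub_ne_zero hx) hmem
      rw [← htr, ← map_mul] at h1
      obtain ⟨L, hL, hprod, hlen⟩ := ih (t * w) (by omega)
      refine ⟨t :: L, ?_, ?_, by simp [hlen]⟩
      · intro s hs
        rcases List.mem_cons.1 hs with rfl | hs
        · exact ht
        · exact hL s hs
      · have htt : t * t = 1 := rep_injective (by
          rw [map_mul, htr, rootReflection_mul_self, map_one])
        rw [List.prod_cons, hprod, ← mul_assoc, htt, one_mul]
  apply le_antisymm
  · exact Nat.sInf_le (upper _ w rfl)
  · obtain ⟨L, hL, hprod, hlen⟩ := Nat.sInf_mem (⟨_, upper _ w rfl⟩ :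
      {k | ∃ L : List (W n), (∀ t ∈ L, t ∈ reflections n) ∧ L.prod = w ∧ L.length = k}.Nonempty)
    rw [absLength, ← hlen, ← hprod]
    exact lower L hL

theorem absLE_iff {v w : W n} : AbsLE v w ↔ OrthLE (rep v) (rep w) := by
  rw [AbsLE, OrthLE, absLength_eq, absLength_eq, absLength_eq, map_mul, map_inv]

end TypeB

/-! ### Coxeter elements are `2n`-cycles; labellings of the polygon. -/

namespace TypeB

variable {n : ℕ}

theorem pairedSwap_apply (i j : Fin n) (x : SignedIndex n) :
    (pairedSwap i j).1 x = (Equiv.swap i j x.1, x.2) := rfl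

/-- The positions `(j, e)` with `j ≤ i`. -/
def initialSegment (i : Fin n) (e : ℤˣ) : Finset (SignedIndex n) :=
  Finset.univ.filter fun x => x.1 ≤ i ∧ x.2 = e

theorem mem_initialSegment {i : Fin n} {e : ℤˣ} {x : SignedIndex n} :
    x ∈ initialSegment i e ↔ x.1 ≤ i ∧ x.2 = e := by
  simp [initialSegment]

/-- For `k < i` the swap stays inside the segment, and for `k > i` nothing in the segment moves.
Only `simple i` can lead out of it. -/
theorem simple_apply_mem {i k : Fin n} (hk : k ≠ i) {e : ℤˣ} {x : SignedIndex n}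
    (hx : x ∈ initialSegment i e) : (simple k).1 x ∈ initialSegment i e := by
  rw [mem_initialSegment] at hx ⊢
  have hki : (k : ℕ) ≠ i := fun h => hk (Fin.ext h)
  have hi := i.isLt
  have hxi : (x.1 : ℕ) ≤ i := hx.1
  unfold simple
  split_ifs with h
  · rw [pairedSwap_apply]
    refine ⟨?_, hx.2⟩
    rw [Equiv.swap_apply_def]
    split_ifs with h1 h2
    · rw [h1] at hxi
      change (k : ℕ) + 1 ≤ i
      omega
    · have h3 : (k : ℕ) + 1 ≤ i := by rw [h2] at hxi; exact hxi
      change (k : ℕ) ≤ i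
      omega
    · exact hx.1
  · have hne : x.1 ≠ k := by
      intro h'
      rw [h'] at hxi
      omega
    rw [signSwap]
    simp only
    rw [Equiv.swap_apply_of_ne_of_ne]
    · exact hx
    · exact fun h' => hne (congrArg Prod.fst h')
    · exact fun h' => hne (congrArg Prod.fst h')

theorem simple_mul_self (i : Fin n) : simple i * simple i = 1 := by
  apply Subtype.ext
  apply Equiv.ext
  intro x
  unfold simple
  split_ifs with h
  · change (pairedSwap _ _).1 ((pairedSwap _ _).1 x) = x
    simp [pairedSwap_apply]
  · exact Equiv.congr_fun (Equiv.swap_mul_self _ _) x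

theorem simple_apply_apply (i : Fin n) (x : SignedIndex n) :
    (simple i).1 ((simple i).1 x) = x := by
  have := congrArg (fun w : W n => w.1 x) (simple_mul_self i)
  exact this

theorem simple_apply_eq_self {i : Fin n} {x : SignedIndex n} (h1 : x.1 ≠ i)
    (h2 : ∀ e, x ≠ (simple i).1 (i, e)) : (simple i).1 x = x := by
  unfold simple at h2 ⊢
  split_ifs with h
  · simp only [dif_pos h] at h2
    have h3 : x.1 ≠ ⟨i + 1, h⟩ := by
      intro h3
      apply h2 x.2
      rw [pairedSwap_apply]
      simp [Prod.ext_iff, h3]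
    rw [pairedSwap_apply, Equiv.swap_apply_of_ne_of_ne h1 h3]
  · exact Equiv.swap_apply_of_ne_of_ne (fun h' => h1 (congrArg Prod.fst h'))
      (fun h' => h1 (congrArg Prod.fst h'))

theorem simple_apply_eq_self_of_mem {i : Fin n} {e : ℤˣ} {x : SignedIndex n}
    (hx : x ∈ initialSegment i e) (hne : x ≠ (i, e)) : (simple i).1 x = x := by
  rw [mem_initialSegment] at hx
  have h1 : x.1 ≠ i := fun h => hne (Prod.ext h hx.2)
  have hlt : (x.1 : ℕ) < i := lt_of_le_of_ne hx.1 fun h => h1 (Fin.ext h)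
  unfold simple
  split_ifs with h
  · have h3 : x.1 ≠ ⟨i + 1, h⟩ := by
      intro h3
      rw [h3] at hlt
      simp only at hlt
      omega
    rw [pairedSwap_apply, Equiv.swap_apply_of_ne_of_ne h1 h3]
  · exact Equiv.swap_apply_of_ne_of_ne (fun h' => h1 (congrArg Prod.fst h'))
      (fun h' => h1 (congrArg Prod.fst h'))

theorem sum_simple_apply {i k : Fin n} (hk : k ≠ i) (e : ℤˣ) (g : SignedIndex n → ℤ) :
    ∑ x ∈ initialSegment i e, g ((simple k).1 x) = ∑ x ∈ initialSegment i e, g x :=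
  Finset.sum_nbij' (simple k).1 (simple k).1 (fun _ hx => simple_apply_mem hk hx)
    (fun _ hx => simple_apply_mem hk hx) (fun x _ => simple_apply_apply k x)
    (fun x _ => simple_apply_apply k x) (fun _ _ => rfl)

theorem sum_list_prod_apply {i : Fin n} (e : ℤˣ) (L : List (Fin n)) (hL : i ∉ L)
    (g : SignedIndex n → ℤ) :
    ∑ x ∈ initialSegment i e, g ((L.map simple).prod.1 x) = ∑ x ∈ initialSegment i e, g x := by
  induction L generalizing g with
  | nil => rfl
  | cons k L ih =>
    rw [List.mem_cons, not_or] at hL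
    rw [← sum_simple_apply (Ne.symm hL.1) e g, ← ih hL.2 fun x => g ((simple k).1 x)]
    rfl

/-- A function that is invariant under a product of distinct simple reflections is invariant
under each of them. -/
theorem invariant_simple_of_invariant_prod (L : List (Fin n)) (hL : L.Nodup)
    (g : SignedIndex n → ℤ) (hg : ∀ x, g ((L.map simple).prod.1 x) = g x) :
    ∀ i ∈ L, ∀ x, g ((simple i).1 x) = g x := by
  induction L with
  | nil => simp
  | cons i L ih =>
    rw [List.nodup_cons] at hL
    have hcons : ∀ x, ((i :: L).map simple).prod.1 x = (simple i).1 ((L.map simple).prod.1 x) :=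
      fun _ => rfl
    have hi : ∀ e, g ((simple i).1 (i, e)) = g (i, e) := by
      intro e
      -- Sum `g ∘ simple i` over the segment. The remaining factors permute the segment, so the
      -- invariance of `g` makes this equal to the sum of `g`. All terms except the one at `(i, e)`
      -- agree, hence that one does too.
      have h1 := sum_list_prod_apply e L hL.1 fun x => g ((simple i).1 x)
      simp only [← hcons, hg] at h1
      have hmem : (i, e) ∈ initialSegment i e := by simp [mem_initialSegment]
      rw [← Finset.add_sum_erase _ _ hmem, ← Finset.add_sum_erase _ _ hmem] at h1
      have h2 : ∑ x ∈ (initialSegment i e).erase (i, e), g ((simple i).1 x) =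
          ∑ x ∈ (initialSegment i e).erase (i, e), g x := by
        apply Finset.sum_congr rfl
        intro x hx
        rw [Finset.mem_erase] at hx
        rw [simple_apply_eq_self_of_mem hx.2 hx.1]
      rw [h2] at h1
      exact (add_right_cancel h1).symm
    have hinv : ∀ x, g ((simple i).1 x) = g x := by
      intro x
      by_cases h1 : x.1 = i
      · obtain ⟨j, e⟩ := x
        simp only at h1
        rw [h1, hi]
      by_cases h2 : ∃ e, x = (simple i).1 (i, e)
      · obtain ⟨e, rfl⟩ := h2
        rw [simple_apply_apply, hi]
      push Not at h2
      rw [simple_apply_eq_self h1 h2]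
    intro k hk
    rcases List.mem_cons.1 hk with rfl | hk
    · exact hinv
    · refine ih hL.2 (fun x => ?_) k hk
      rw [← hinv, ← hcons, hg]

theorem eq_of_invariant_simple (g : SignedIndex n → ℤ)
    (hg : ∀ i x, g ((simple i).1 x) = g x) (x y : SignedIndex n) : g x = g y := by
  have hpos : 0 < n := x.1.pos
  have h0 : ∀ (k : ℕ) (hk : k < n) (e : ℤˣ), g (⟨k, hk⟩, e) = g (⟨0, hpos⟩, e) := by
    intro k
    induction k with
    | zero => exact fun _ _ => rfl
    | succ k ih =>
      intro hk e
      rw [← ih (by omega), ← hg ⟨k, by omega⟩ (⟨k, by omega⟩, e), simple, dif_pos hk,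
        pairedSwap_apply, Equiv.swap_apply_left]
  have h1 : ∀ e, g (⟨0, hpos⟩, e) = g (⟨0, hpos⟩, 1) := by
    intro e
    rcases Int.units_eq_one_or e with rfl | rfl
    · rfl
    · have hn : n - 1 < n := by omega
      have := hg ⟨n - 1, hn⟩ (⟨n - 1, hn⟩, 1)
      rw [simple, dif_neg (by simp only; omega), signSwap] at this
      simp only [Equiv.swap_apply_left] at this
      rw [h0 _ _ (-1), h0 _ _ 1] at this
      exact this
  have h2 : ∀ z : SignedIndex n, g z = g (⟨0, hpos⟩, 1) := by
    rintro ⟨⟨k, hk⟩, e⟩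
    rw [h0, h1]
  rw [h2 x, h2 y]

/-- The indicator function of a cycle of the product is invariant under the product, hence under
each simple reflection; these act transitively, so the function is constant. -/
theorem sameCycle_of_isCoxeterElement {c : W n} (hc : IsCoxeterElement c) (x y : SignedIndex n) :
    c.1.SameCycle x y := by
  classical
  obtain ⟨σ, w, rfl⟩ := hc
  have hmap : (List.ofFn fun i => simple (σ i)) = (List.ofFn σ).map simple := by
    rw [List.map_ofFn]; rfl
  rw [hmap]
  have key : ∀ x y, ((List.ofFn σ).map simple).prod.1.SameCycle x y := by
    intro x y
    let g : SignedIndex n → ℤ :=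
      fun z => if ((List.ofFn σ).map simple).prod.1.SameCycle x z then 1 else 0
    have hg := invariant_simple_of_invariant_prod (List.ofFn σ)
      (List.nodup_ofFn.2 σ.injective) g (fun z => by
        simp only [g, Equiv.Perm.sameCycle_apply_right])
    have h := eq_of_invariant_simple g (fun i => hg i (by
      rw [List.mem_ofFn]; exact σ.surjective i)) x y
    by_contra hne
    simp only [g, if_neg hne, if_pos (Equiv.Perm.SameCycle.refl _ x)] at h
    exact one_ne_zero h
  have := Equiv.Perm.SameCycle.conj (g := w.1) (key (w.1⁻¹ x) (w.1⁻¹ y))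
  simpa using this

theorem exists_isPolygonLabelling {c : W n} (hn : 0 < n) (hc : IsCoxeterElement c) :
    ∃ f : ZMod (2 * n) ≃ SignedIndex n, IsPolygonLabelling c f := by
  have : NeZero (2 * n) := ⟨by omega⟩
  let x₀ : SignedIndex n := (⟨0, hn⟩, 1)
  have hcyc : c.1.IsCycleOn (Finset.univ : Finset (SignedIndex n)) := by
    refine ⟨?_, fun x _ y _ => sameCycle_of_isCoxeterElement hc x y⟩
    simp [Set.bijOn_univ]
  have hcard : (Finset.univ : Finset (SignedIndex n)).card = 2 * n := by
    simp [mul_comm]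
  have hpow : (c.1 ^ (2 * n)) x₀ = x₀ := by
    rw [← hcard]
    exact hcyc.pow_card_apply (Finset.mem_univ _)
  -- The choice of representative does not matter, because the power `2n` of `c` fixes `x₀`.
  let f : ZMod (2 * n) → SignedIndex n := fun k => (c.1 ^ k.val) x₀
  have hf : ∀ m : ℕ, f m = (c.1 ^ m) x₀ := by
    intro m
    simp only [f, ZMod.val_natCast]
    conv_rhs => rw [← Nat.mod_add_div m (2 * n), pow_add, pow_mul, Equiv.Perm.mul_apply]
    congr 1
    have hfix : ∀ j : ℕ, ((c.1 ^ (2 * n)) ^ j) x₀ = x₀ := by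
      intro j
      induction j with
      | zero => rfl
      | succ j ih => rw [pow_succ, Equiv.Perm.mul_apply, hpow, ih]
    exact (hfix _).symm
  have hsurj : Function.Surjective f := by
    intro y
    obtain ⟨m, -, hm⟩ := hcyc.exists_pow_eq (Finset.mem_univ x₀) (Finset.mem_univ y)
    exact ⟨m, by rw [hf, hm]⟩
  have hbij : Function.Bijective f := by
    rw [Fintype.bijective_iff_surjective_and_card]
    refine ⟨hsurj, ?_⟩
    rw [ZMod.card, ← hcard, Finset.card_univ]
  refine ⟨Equiv.ofBijective f hbij, fun k => ?_⟩
  obtain ⟨m, rfl⟩ := ZMod.natCast_zmod_surjective k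
  have h := hf (m + 1)
  rw [Nat.cast_add, Nat.cast_one] at h
  rw [Equiv.ofBijective_apply, Equiv.ofBijective_apply, h, hf, pow_succ', Equiv.Perm.mul_apply]

section Labelling

variable {c : W n} {f : ZMod (2 * n) ≃ SignedIndex n}

theorem zmod_induction {m : ℕ} {P : ZMod m → Prop} (h0 : P 0) (h1 : ∀ k, P k → P (k + 1))
    [NeZero m] (k : ZMod m) : P k := by
  obtain ⟨j, rfl⟩ := ZMod.natCast_zmod_surjective k
  induction j with
  | zero => simpa using h0
  | succ j ih => push_cast; exact h1 _ ih

/-- Commuting with the one-step rotation forces a rotation of the labels, determined by the image of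
vertex `0`. -/
theorem IsPolygonLabelling.apply_of_commute [NeZero n] (hf : IsPolygonLabelling c f)
    {u : SignedIndex n → SignedIndex n} (hu : ∀ x, u (c.1 x) = c.1 (u x)) (k : ZMod (2 * n)) :
    u (f k) = f (k + f.symm (u (f 0))) := by
  induction k using zmod_induction with
  | h0 => simp
  | h1 k ih => rw [hf, hu, ih, ← hf]; congr 1; ring

/-- Maps that reverse `c` are reflections of the labels. -/
theorem IsPolygonLabelling.apply_of_reverse [NeZero n] (hf : IsPolygonLabelling c f)
    {u : SignedIndex n → SignedIndex n} (hu : ∀ x, c.1 (u (c.1 x)) = u x) (k : ZMod (2 * n)) :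
    u (f k) = f (f.symm (u (f 0)) - k) := by
  induction k using zmod_induction with
  | h0 => simp
  | h1 k ih =>
    apply c.1.injective
    rw [hf, hu, ih, ← hf]
    congr 1
    ring

theorem eq_natCast_of_two_mul_eq_zero [NeZero n] {a : ZMod (2 * n)} (h : a + a = 0)
    (ha : a ≠ 0) : a = (n : ZMod (2 * n)) := by
  obtain ⟨j, hj, rfl⟩ : ∃ j : ℕ, j < 2 * n ∧ (j : ZMod (2 * n)) = a :=
    ⟨a.val, ZMod.val_lt a, ZMod.natCast_zmod_val a⟩
  rw [← Nat.cast_add, ZMod.natCast_eq_zero_iff] at h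
  have hj0 : j ≠ 0 := fun h0 => ha (by simp [h0])
  obtain ⟨q, hq⟩ := h
  have : q = 1 := by
    have h1 : q < 2 := by nlinarith
    have h2 : 0 < q := by
      rcases Nat.eq_zero_or_pos q with h | h
      · rw [h] at hq; omega
      · exact h
    omega
  rw [this] at hq
  congr 1
  omega

/-- The sign change commutes with `c`, so it is a rotation; being an involution without fixed
points, it is the half turn. -/
theorem IsPolygonLabelling.add_natCast [NeZero n] (hf : IsPolygonLabelling c f)
    (k : ZMod (2 * n)) : f (k + n) = flip (f k) := by
  have h := hf.apply_of_commute (u := flip) fun x => (apply_flip c x).symm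
  set a := f.symm (flip (f 0))
  have h2 := h 0
  have h3 := h (0 + a)
  rw [← h2, flip_flip] at h3
  have h4 := f.injective h3
  have ha : a ≠ 0 := by
    intro h0
    rw [h0, add_zero] at h2
    exact flip_ne _ h2
  rw [h, ← eq_natCast_of_two_mul_eq_zero (a := a) (by rw [zero_add] at h4; exact h4.symm) ha]

end Labelling

end TypeB

/-! ### Rank of non-crossing partitions and chords of the polygon as atoms. -/

namespace TypeB

open Module

variable {n : ℕ}

/-- Moved spaces are spanned by the roots they contain, so they can be compared root by root. -/
theorem movSpace_rep_le {w : W n} {S : Submodule ℝ (EuclideanSpace ℝ (Fin n))}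
    (h : ∀ x, w.1 x ≠ x → signedVec (w.1 x) - signedVec x ∈ S) : movSpace (rep w) ≤ S := by
  have h' : ∀ x, subOne (rep w) (signedVec x) ∈ S := by
    intro x
    have : subOne (rep w) (signedVec x) = signedVec (w.1 x) - signedVec x := by
      rw [← rep_signedVec]; rfl
    rw [this]
    by_cases hx : w.1 x = x
    · rw [hx, sub_self]; exact S.zero_mem
    · exact h x hx
  rintro _ ⟨v, rfl⟩
  have hv : v ∈ Submodule.span ℝ (Set.range (EuclideanSpace.basisFun (Fin n) ℝ).toBasis) := by
    rw [Basis.span_eq]; trivial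
  have hle : Submodule.span ℝ (Set.range (EuclideanSpace.basisFun (Fin n) ℝ).toBasis) ≤
      S.comap (subOne (rep w)) := by
    rw [Submodule.span_le]
    rintro _ ⟨i, rfl⟩
    have := h' (i, 1)
    simpa [signedVec] using this
  exact hle hv

theorem eq_zero_of_inner_signedVec {v : EuclideanSpace ℝ (Fin n)}
    (h : ∀ x, inner ℝ (signedVec x) v = 0) : v = 0 := by
  ext i
  have := h (i, 1)
  simpa [signedVec, EuclideanSpace.inner_single_left] using this

theorem exists_apply_ne {w : W n} (h : movRank (rep w) ≠ 0) : ∃ x, w.1 x ≠ x := by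
  by_contra! hall
  have : w = 1 := Subtype.ext (Equiv.ext hall)
  rw [this, map_one, movRank_one] at h
  exact h rfl

section NCBasic

variable {c : W n}

/-- The non-crossing partition given by an element below `c`. -/
def NC.mk (w : W n) (h : AbsLE w c) : NC c := ⟨w, h⟩

/-- The rank of a non-crossing partition. -/
noncomputable def NC.rank (w : NC c) : ℕ := movRank (rep w.1)

/-- The moved space of a non-crossing partition. -/
noncomputable def NC.mov (w : NC c) : Submodule ℝ (EuclideanSpace ℝ (Fin n)) := movSpace (rep w.1)

theorem NC.le_iff {v w : NC c} : v ≤ w ↔ OrthLE (rep v.1) (rep w.1) := absLE_iff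

theorem NC.orthLE (w : NC c) : OrthLE (rep w.1) (rep c) := absLE_iff.1 w.2

theorem NC.eq_of_mov_eq {v w : NC c} (h : v.mov = w.mov) : v = w :=
  Subtype.ext (rep_injective (v.orthLE.eq_of_movSpace_eq w.orthLE h))

theorem NC.eq_of_le_of_rank_le {v w : NC c} (h : v ≤ w) (h' : w.rank ≤ v.rank) : v = w :=
  Subtype.ext (rep_injective ((NC.le_iff.1 h).eq_of_movRank_le h'))

theorem NC.exists_le_rank_add_one {w : NC c} (h : w.rank ≠ 0) :
    ∃ v : NC c, v ≤ w ∧ v.rank + 1 = w.rank := by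
  obtain ⟨x, hx⟩ := exists_apply_ne h
  obtain ⟨t, -, ht⟩ := exists_reflection hx
  have hmem : signedVec (w.1.1 x) - signedVec x ∈ movSpace (rep w.1) := by
    rw [← rep_signedVec]
    exact sub_mem_movSpace _ _
  have h1 := movRank_mul_rootReflection_add_one (signedVec_sub_ne_zero hx) hmem
  have hle : OrthLE (rep (w.1 * t)) (rep w.1) := by
    rw [OrthLE, ← map_inv, ← map_mul]
    have : (w.1 * t)⁻¹ * w.1 = t⁻¹ := by group
    rw [this, map_inv, movRank_inv, map_mul, ht,
      movRank_rootReflection (signedVec_sub_ne_zero hx), h1]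
  refine ⟨NC.mk (w.1 * t) (absLE_iff.2 (hle.trans w.orthLE)), NC.le_iff.2 hle, ?_⟩
  change movRank (rep (w.1 * t)) + 1 = movRank (rep w.1)
  rw [map_mul, ht, h1]

/-- Every element of nonzero rank covers one of rank one less, and rank strictly increases along the
order. Induction gives one inequality for every automorphism; its inverse gives the other. -/
theorem NC.rank_apply (φ : NC c ≃o NC c) (w : NC c) : (φ w).rank = w.rank := by
  have key : ∀ (ψ : NC c ≃o NC c) (k : ℕ) (v : NC c), v.rank = k → k ≤ (ψ v).rank := by
    intro ψ k
    induction k with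
    | zero => exact fun _ _ => Nat.zero_le _
    | succ k ih =>
      intro v hv
      obtain ⟨u, hu, hr⟩ := NC.exists_le_rank_add_one (w := v) (by omega)
      have h1 := ih u (by omega)
      have h2 : ψ u ≤ ψ v := ψ.map_rel_iff.2 hu
      by_contra hlt
      have h3 := ψ.injective (NC.eq_of_le_of_rank_le h2 (by omega))
      rw [h3] at hr
      omega
  apply le_antisymm
  · simpa using key φ.symm _ (φ w) rfl
  · exact key φ _ w rfl

end NCBasic

section Labelling

variable {c : W n} {f : ZMod (2 * n) ≃ SignedIndex n}

/-- The signed coordinate vector at a vertex of the `2n`-gon. -/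
noncomputable def vec (f : ZMod (2 * n) ≃ SignedIndex n) (k : ZMod (2 * n)) :
    EuclideanSpace ℝ (Fin n) := signedVec (f k)

/-- The vertices `a` and `b` lie on different diameters. -/
def Apart (a b : ZMod (2 * n)) : Prop := a ≠ b ∧ a ≠ b + n

theorem natCast_ne {i j : ℕ} (h : i < j) (h' : j < i + 2 * n) :
    (i : ZMod (2 * n)) ≠ (j : ZMod (2 * n)) := by
  intro he
  rw [ZMod.natCast_eq_natCast_iff, Nat.modEq_iff_dvd' h.le] at he
  have := Nat.le_of_dvd (by omega) he
  omega

theorem add_natCast_self : (n : ZMod (2 * n)) + n = 0 := by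
  have : ((2 * n : ℕ) : ZMod (2 * n)) = 0 := ZMod.natCast_self _
  rw [← this]
  push_cast
  ring

theorem Apart.symm {a b : ZMod (2 * n)} (h : Apart a b) : Apart b a := by
  refine ⟨h.1.symm, fun h' => h.2 ?_⟩
  rw [h', add_assoc, add_natCast_self, add_zero]

theorem vec_inner_self (k : ZMod (2 * n)) : inner ℝ (vec f k) (vec f k) = 1 :=
  inner_signedVec_self _

theorem vec_sub_ne_zero {k l : ZMod (2 * n)} (h : k ≠ l) : vec f k - vec f l ≠ 0 :=
  signedVec_sub_ne_zero fun h' => h (f.injective h')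

theorem IsPolygonLabelling.rep_vec (hf : IsPolygonLabelling c f) (k : ZMod (2 * n)) :
    rep c (vec f k) = vec f (k + 1) := by
  rw [vec, rep_signedVec, ← hf, vec]

theorem eq_or_eq_of_not_apart {a b : ZMod (2 * n)} (h : ¬Apart a b) : a = b ∨ a = b + n := by
  unfold Apart at h
  tauto

open Classical in
/-- The reflection that exchanges the vertices `k` and `l`. -/
noncomputable def chord (f : ZMod (2 * n) ≃ SignedIndex n) (k l : ZMod (2 * n)) : W n :=
  if h : f k ≠ f l then (exists_reflection h).choose else 1

theorem rep_chord {k l : ZMod (2 * n)} (h : k ≠ l) :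
    rep (chord f k l) = rootReflection (vec f k - vec f l) := by
  have h' : f k ≠ f l := fun he => h (f.injective he)
  rw [chord, dif_pos h']
  exact (exists_reflection h').choose_spec.2

theorem apart_add (k : ZMod (2 * n)) {i j : ℕ} (h : i < j) (h' : j < i + n) :
    Apart (k + (i : ZMod (2 * n))) (k + (j : ZMod (2 * n))) := by
  refine ⟨fun he => natCast_ne h (by omega) (add_left_cancel he), fun he => ?_⟩
  rw [add_assoc, ← Nat.cast_add] at he
  exact natCast_ne (by omega) (by omega) (add_left_cancel he)

theorem apart_add_one (hn : 2 ≤ n) (k : ZMod (2 * n)) : Apart k (k + 1) := by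
  simpa using apart_add k (i := 0) (j := 1) (by omega) (by omega)

variable [NeZero n]

theorem IsPolygonLabelling.vec_add (hf : IsPolygonLabelling c f) (k : ZMod (2 * n)) :
    vec f (k + n) = -vec f k := by
  rw [vec, hf.add_natCast, signedVec_flip, vec]

theorem IsPolygonLabelling.inner_vec (hf : IsPolygonLabelling c f) {a b : ZMod (2 * n)}
    (h : Apart a b) : inner ℝ (vec f a) (vec f b) = 0 := by
  apply inner_signedVec_of_ne
  · exact fun h' => h.1 (f.injective h')
  · rw [← hf.add_natCast]
    exact fun h' => h.2 (f.injective h')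

theorem IsPolygonLabelling.inner_vec_add (hf : IsPolygonLabelling c f) (k : ZMod (2 * n))
    {i j : ℕ} (h : i < j + n) (h' : j < i + n) :
    inner ℝ (vec f (k + i)) (vec f (k + j)) = if i = j then 1 else 0 := by
  split_ifs with hij
  · rw [hij, vec_inner_self]
  · rcases Nat.lt_or_gt_of_ne hij with hlt | hlt
    · exact hf.inner_vec (apart_add k hlt h')
    · exact hf.inner_vec (apart_add k hlt h).symm

theorem IsPolygonLabelling.apart_or_vec_mem (hf : IsPolygonLabelling c f) (a b : ZMod (2 * n)) :
    Apart a b ∨ vec f b ∈ Submodule.span ℝ {vec f a} := by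
  by_cases h : Apart a b
  · exact Or.inl h
  · right
    rw [Submodule.mem_span_singleton]
    rcases eq_or_eq_of_not_apart h with rfl | rfl
    · exact ⟨1, one_smul _ _⟩
    · exact ⟨-1, by rw [hf.vec_add]; simp⟩

theorem IsPolygonLabelling.inner_eq_zero_or (hf : IsPolygonLabelling c f)
    {a b : ZMod (2 * n)} (h : Apart a b) (p : ZMod (2 * n)) :
    inner ℝ (vec f p) (vec f a) = 0 ∨ inner ℝ (vec f p) (vec f b) = 0 := by
  by_cases hb : Apart p b
  · exact Or.inr (hf.inner_vec hb)
  · left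
    rw [real_inner_comm]
    rcases eq_or_eq_of_not_apart hb with rfl | rfl
    · exact hf.inner_vec h
    · rw [hf.vec_add, inner_neg_right, hf.inner_vec h, neg_zero]

/-- A root has at most two nonzero coordinates. -/
theorem IsPolygonLabelling.root_inner_eq_zero_or (hf : IsPolygonLabelling c f)
    {a b d : ZMod (2 * n)} (hab : Apart a b) (had : Apart a d) (hbd : Apart b d)
    (p q : ZMod (2 * n)) :
    inner ℝ (vec f p - vec f q) (vec f a) = 0 ∨ inner ℝ (vec f p - vec f q) (vec f b) = 0 ∨
      inner ℝ (vec f p - vec f q) (vec f d) = 0 := by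
  have hz : ∀ e, inner ℝ (vec f p) (vec f e) = 0 → inner ℝ (vec f q) (vec f e) = 0 →
      inner ℝ (vec f p - vec f q) (vec f e) = 0 := by
    intro e h1 h2
    rw [inner_sub_left, h1, h2, sub_zero]
  have h1 := hf.inner_eq_zero_or hab p
  have h2 := hf.inner_eq_zero_or had p
  have h3 := hf.inner_eq_zero_or hbd p
  have h4 := hf.inner_eq_zero_or hab q
  have h5 := hf.inner_eq_zero_or had q
  have h6 := hf.inner_eq_zero_or hbd q
  rcases h1 with h1 | h1
  · rcases h4 with h4 | h4
    · exact Or.inl (hz a h1 h4)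
    rcases h3 with h3 | h3
    · exact Or.inr (Or.inl (hz b h3 h4))
    rcases h5 with h5 | h5
    · exact Or.inl (hz a h1 h5)
    · exact Or.inr (Or.inr (hz d h3 h5))
  · rcases h4 with h4 | h4
    · rcases h2 with h2 | h2
      · exact Or.inl (hz a h2 h4)
      rcases h6 with h6 | h6
      · exact Or.inr (Or.inl (hz b h1 h6))
      · exact Or.inr (Or.inr (hz d h2 h6))
    · exact Or.inr (Or.inl (hz b h1 h4))

/-- The inner product of a fixed vector with `vec f k` does not depend on `k`, yet changes sign
under the half turn. -/
theorem IsPolygonLabelling.fixSpace_rep (hf : IsPolygonLabelling c f) : fixSpace (rep c) = ⊥ := by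
  rw [eq_bot_iff]
  intro v hv
  rw [mem_fixSpace] at hv
  rw [Submodule.mem_bot]
  apply eq_zero_of_inner_signedVec
  have hconst : ∀ k, inner ℝ (vec f k) v = inner ℝ (vec f 0) v := by
    intro k
    induction k using zmod_induction with
    | h0 => rfl
    | h1 k ih => rw [← ih, ← hf.rep_vec, ← (rep c).inner_map_map (vec f k) v, hv]
  have h0 : inner ℝ (vec f 0) v = 0 := by
    have h1 := hconst (0 + n)
    rw [hf.vec_add, inner_neg_left] at h1
    linarith
  intro x
  have := hconst (f.symm x)
  rw [vec, Equiv.apply_symm_apply, h0] at this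
  exact this

theorem IsPolygonLabelling.mem_movSpace_rep (hf : IsPolygonLabelling c f)
    (v : EuclideanSpace ℝ (Fin n)) : v ∈ movSpace (rep c) := by
  rw [movSpace_eq_orthogonal, hf.fixSpace_rep, Submodule.bot_orthogonal_eq_top]
  trivial

theorem IsPolygonLabelling.chord_absLE (hf : IsPolygonLabelling c f) (k l : ZMod (2 * n)) :
    AbsLE (chord f k l) c := by
  rw [absLE_iff]
  by_cases h : k = l
  -- The degenerate chord is the identity by convention.
  · rw [chord, dif_neg (by simp [h]), map_one, OrthLE, movRank_one]
    simp
  · rw [rep_chord h, rootReflection_orthLE_iff (vec_sub_ne_zero h)]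
    exact hf.mem_movSpace_rep _

/-- The reflection that exchanges the vertices `k` and `l`, as a non-crossing partition. -/
noncomputable def IsPolygonLabelling.chordNC (hf : IsPolygonLabelling c f) (k l : ZMod (2 * n)) :
    NC c := ⟨chord f k l, hf.chord_absLE k l⟩

variable (hf : IsPolygonLabelling c f)
variable {k l p q : ZMod (2 * n)}

theorem chordNC_rank (h : k ≠ l) : (hf.chordNC k l).rank = 1 := by
  rw [NC.rank]
  change movRank (rep (chord f k l)) = 1
  rw [rep_chord h, movRank_rootReflection (vec_sub_ne_zero h)]

theorem chordNC_mov (h : k ≠ l) : (hf.chordNC k l).mov = Submodule.span ℝ {vec f k - vec f l} := by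
  rw [NC.mov]
  change movSpace (rep (chord f k l)) = _
  rw [rep_chord h, movSpace_rootReflection]

theorem chordNC_le_iff (h : k ≠ l) {w : NC c} : hf.chordNC k l ≤ w ↔ vec f k - vec f l ∈ w.mov := by
  rw [NC.le_iff]
  change OrthLE (rep (chord f k l)) _ ↔ _
  rw [rep_chord h, rootReflection_orthLE_iff (vec_sub_ne_zero h)]
  rfl

/-- The moved space of an atom is the line of its root, and it determines the atom. -/
theorem chordNC_eq_of_smul (hpq : p ≠ q) (hkl : k ≠ l) {r : ℝ}
    (h : vec f p - vec f q = r • (vec f k - vec f l)) : hf.chordNC p q = hf.chordNC k l := by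
  have hr : r ≠ 0 := by
    rintro rfl
    rw [zero_smul] at h
    exact vec_sub_ne_zero hpq h
  apply NC.eq_of_mov_eq
  rw [chordNC_mov hf hpq, chordNC_mov hf hkl, h,
    Submodule.span_singleton_smul_eq (IsUnit.mk0 r hr)]

theorem chordNC_comm (h : k ≠ l) : hf.chordNC k l = hf.chordNC l k :=
  chordNC_eq_of_smul hf h h.symm (r := -1) (by module)

theorem chordNC_add (h : k ≠ l) : hf.chordNC (k + n) (l + n) = hf.chordNC k l := by
  apply chordNC_eq_of_smul hf (fun h' => h (add_right_cancel h')) h (r := -1)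
  rw [hf.vec_add, hf.vec_add]
  module

theorem chordNC_ne (hkl : k ≠ l) (hpq : p ≠ q) {v : EuclideanSpace ℝ (Fin n)}
    (h : inner ℝ (vec f k - vec f l) v = 0) (h' : inner ℝ (vec f p - vec f q) v ≠ 0) :
    hf.chordNC k l ≠ hf.chordNC p q := by
  intro he
  have hmov := chordNC_mov hf hpq
  rw [← he, chordNC_mov hf hkl] at hmov
  have hmem : vec f p - vec f q ∈ Submodule.span ℝ {vec f k - vec f l} := by
    rw [hmov]; exact Submodule.mem_span_singleton_self _
  obtain ⟨r, hr⟩ := Submodule.mem_span_singleton.1 hmem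
  rw [← hr, inner_smul_left, h, mul_zero] at h'
  exact h' rfl

theorem exists_eq_chordNC {a : NC c} (ha : a.rank = 1) : ∃ k l, k ≠ l ∧ a = hf.chordNC k l := by
  obtain ⟨x, hx⟩ := exists_apply_ne (w := a.1) (by unfold NC.rank at ha; omega)
  have hne : f.symm (a.1.1 x) ≠ f.symm x := fun h => hx (f.symm.injective h)
  refine ⟨f.symm (a.1.1 x), f.symm x, hne, ?_⟩
  symm
  apply NC.eq_of_le_of_rank_le
  · rw [chordNC_le_iff hf hne, vec, vec, Equiv.apply_symm_apply, Equiv.apply_symm_apply,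
      ← rep_signedVec]
    exact sub_mem_movSpace _ _
  · rw [chordNC_rank hf hne, ha]

/-- One of the two arcs between the endpoints has at most `n` steps; `m = n` is the case of a
diameter. -/
theorem chordNC_normal_form (h : k ≠ l) :
    ∃ (p : ZMod (2 * n)) (m : ℕ), 1 ≤ m ∧ m ≤ n ∧ hf.chordNC k l = hf.chordNC p (p + m) := by
  have hval : ∀ z : ZMod (2 * n), ((z.val : ℕ) : ZMod (2 * n)) = z := ZMod.natCast_zmod_val
  have hpos : ∀ z : ZMod (2 * n), z ≠ 0 → 1 ≤ z.val := by
    intro z hz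
    exact Nat.one_le_iff_ne_zero.2 fun h0 => hz ((ZMod.val_eq_zero z).1 h0)
  by_cases hle : (l - k).val ≤ n
  · refine ⟨k, (l - k).val, hpos _ (sub_ne_zero.2 h.symm), hle, ?_⟩
    rw [hval, add_sub_cancel]
  · refine ⟨l, (k - l).val, hpos _ (sub_ne_zero.2 h), ?_, ?_⟩
    · have h1 : k - l = -(l - k) := by ring
      have : NeZero (l - k) := ⟨sub_ne_zero.2 h.symm⟩
      rw [h1, ZMod.val_neg_of_ne_zero]
      omega
    · rw [hval, add_sub_cancel, chordNC_comm hf h]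

theorem mov_subset_span {w : NC c} (hw : w.rank = 2) (hkl : k ≠ l) (hpq : p ≠ q)
    (hne : hf.chordNC k l ≠ hf.chordNC p q) (h1 : hf.chordNC k l ≤ w) (h2 : hf.chordNC p q ≤ w)
    {v : EuclideanSpace ℝ (Fin n)} (hv : v ∈ w.mov) :
    ∃ x y : ℝ, v = x • (vec f k - vec f l) + y • (vec f p - vec f q) := by
  rw [chordNC_le_iff hf hkl] at h1
  rw [chordNC_le_iff hf hpq] at h2
  have hli : LinearIndependent ℝ ![vec f k - vec f l, vec f p - vec f q] := by
    rw [LinearIndependent.pair_iff' (vec_sub_ne_zero hkl)]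
    intro r hr
    exact hne (chordNC_eq_of_smul hf hpq hkl hr.symm).symm
  have hspan : Submodule.span ℝ (Set.range ![vec f k - vec f l, vec f p - vec f q]) = w.mov := by
    apply Submodule.eq_of_le_of_finrank_eq
    · rw [Submodule.span_le]
      rintro _ ⟨i, rfl⟩
      fin_cases i
      · exact h1
      · exact h2
    · rw [finrank_span_eq_card hli]
      exact hw.symm
  rw [← hspan, Matrix.range_cons, Matrix.range_cons, Matrix.range_empty, Set.union_empty,
    Set.singleton_union, Submodule.mem_span_pair] at hv
  obtain ⟨x, y, h⟩ := hv
  exact ⟨x, y, h.symm⟩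

/-- If `c - 1` takes `u` to a root and `u` is orthogonal to a second root, then the two reflections
have an upper bound of rank two. -/
theorem exists_upper_bound (hkl : k ≠ l) (hpq : p ≠ q) {u : EuclideanSpace ℝ (Fin n)}
    (hu : rep c u - u = vec f k - vec f l) (h : inner ℝ u (vec f p - vec f q) = 0) :
    ∃ w : NC c, w.rank = 2 ∧ hf.chordNC k l ≤ w ∧ hf.chordNC p q ≤ w := by
  set a := vec f k - vec f l with ha
  set b := vec f p - vec f q with hb
  have ha0 : a ≠ 0 := vec_sub_ne_zero hkl
  have hb0 : b ≠ 0 := vec_sub_ne_zero hpq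
  have h1 := movRank_rootReflection_mul_add_one ha0 (hf.mem_movSpace_rep a)
  -- A vector `v` fixed by `rootReflection a * rep c` has `c v - v` proportional to `a = c u - u`.
  -- As `c` fixes only zero, `v` is a multiple of `u`, hence orthogonal to `b`.
  have hmem : b ∈ movSpace (rootReflection a * rep c) := by
    rw [movSpace_eq_orthogonal, Submodule.mem_orthogonal]
    intro v hv
    have hv' : rootReflection a v = rep c v := by
      rw [← rootReflection_inv] at hv
      exact orth_mem_fixSpace_inv_mul.1 hv
    obtain ⟨r, hr⟩ := Submodule.mem_span_singleton.1 (rootReflection_apply_sub_mem a v)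
    have hfix : v - r • u ∈ fixSpace (rep c) := by
      rw [mem_fixSpace, map_sub, map_smul, ← hv', eq_add_of_sub_eq hr.symm, eq_add_of_sub_eq hu]
      module
    rw [hf.fixSpace_rep, Submodule.mem_bot, sub_eq_zero] at hfix
    rw [hfix, inner_smul_left, h, mul_zero]
  have h2 := movRank_rootReflection_mul_add_one hb0 hmem
  have hle : movRank (rootReflection a * rootReflection b) ≤ 2 := by
    have := movRank_mul_le (rootReflection a) (rootReflection b)
    rwa [movRank_rootReflection ha0, movRank_rootReflection hb0] at this
  -- The complementary factor has rank two less than `c`, so the product of the two reflections has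
  -- rank exactly two and lies below `c`.
  have hsub := movRank_mul_le (rootReflection a * rootReflection b)
    (rootReflection b * (rootReflection a * rep c))
  have hcancel : rootReflection a * rootReflection b *
      (rootReflection b * (rootReflection a * rep c)) = rep c := by
    rw [mul_assoc, ← mul_assoc (rootReflection b) (rootReflection b), rootReflection_mul_self,
      one_mul, ← mul_assoc, rootReflection_mul_self, one_mul]
  rw [hcancel] at hsub
  have hrep : rep (chord f k l * chord f p q) = rootReflection a * rootReflection b := by
    rw [map_mul, rep_chord hkl, rep_chord hpq]
  have hrank : movRank (rootReflection a * rootReflection b) = 2 := by omega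
  have hle' : OrthLE (rep (chord f k l * chord f p q)) (rep c) := by
    rw [hrep, OrthLE, mul_inv_rev, rootReflection_inv, rootReflection_inv, mul_assoc]
    omega
  refine ⟨NC.mk (chord f k l * chord f p q) (absLE_iff.2 hle'), ?_, ?_, ?_⟩
  · change movRank (rep (chord f k l * chord f p q)) = 2
    rw [hrep, hrank]
  · rw [NC.le_iff]
    change OrthLE (rep (chord f k l)) (rep (chord f k l * chord f p q))
    rw [hrep, rep_chord hkl, OrthLE, inv_mul_cancel_left, movRank_rootReflection ha0,
      movRank_rootReflection hb0, hrank]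
  · rw [NC.le_iff]
    change OrthLE (rep (chord f p q)) (rep (chord f k l * chord f p q))
    rw [hrep, rep_chord hpq, OrthLE, movRank_rootReflection hb0, hrank, rootReflection_inv]
    have hconj := movRank_conj (rootReflection a) (rootReflection b)
    rw [rootReflection_inv, mul_assoc] at hconj
    rw [hconj, movRank_rootReflection ha0]

end Labelling

end TypeB

/-! ### The edges of the polygon among all atoms. -/

namespace TypeB

open Module

variable {n : ℕ}

theorem ne_add_one (hn : 2 ≤ n) (k : ZMod (2 * n)) : k ≠ k + 1 := (apart_add_one hn k).1

theorem ne_add_natCast {m : ℕ} (h : 0 < m) (h' : m < 2 * n) (k : ZMod (2 * n)) :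
    k ≠ k + (m : ZMod (2 * n)) := by
  intro he
  have h0 : (m : ZMod (2 * n)) = 0 := by simpa using he.symm
  exact natCast_ne (n := n) (i := 0) (j := m) h (by omega) (by rw [h0, Nat.cast_zero])

theorem Apart.add_right {a b : ZMod (2 * n)} (h : Apart a b) (z : ZMod (2 * n)) :
    Apart (a + z) (b + z) := by
  refine ⟨fun h' => h.1 (add_right_cancel h'), fun h' => h.2 ?_⟩
  rw [add_right_comm] at h'
  exact add_right_cancel h'

variable [NeZero n] {c : W n} {f : ZMod (2 * n) ≃ SignedIndex n}
variable (hf : IsPolygonLabelling c f) {k l p q : ZMod (2 * n)}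

theorem exists_upper_bound_edge_of_inner_eq_zero (hn : 2 ≤ n) (hpq : p ≠ q)
    (h : inner ℝ (vec f k) (vec f p - vec f q) = 0) :
    ∃ w : NC c, w.rank = 2 ∧ hf.chordNC k (k + 1) ≤ w ∧ hf.chordNC p q ≤ w := by
  apply exists_upper_bound hf (ne_add_one hn k) hpq (u := -vec f k)
  · rw [map_neg, hf.rep_vec]; abel
  · rw [inner_neg_left, h, neg_zero]

/-- The edge reflection swaps the vectors at `k` and `k + 1`, so the reflected root is orthogonal to
the vector at `k`. The rank-two moved space so obtained contains the edge root, is therefore stable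
under the reflection, and contains the original root. -/
theorem exists_upper_bound_edge_of_inner_eq_zero' (hn : 2 ≤ n) (hpq : p ≠ q)
    (h : inner ℝ (vec f (k + 1)) (vec f p - vec f q) = 0) :
    ∃ w : NC c, w.rank = 2 ∧ hf.chordNC k (k + 1) ≤ w ∧ hf.chordNC p q ≤ w := by
  have hk := ne_add_one hn k
  set s := chord f k (k + 1)
  have hs : rep s = rootReflection (vec f k - vec f (k + 1)) := rep_chord hk
  have hvec : ∀ z, rep s (vec f z) = vec f (f.symm (s.1 (f z))) := by
    intro z
    rw [vec, rep_signedVec, vec, Equiv.apply_symm_apply]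
  have hswap : rep s (vec f k) = vec f (k + 1) := by
    rw [hs]
    apply Submodule.reflection_sub
    rw [← sq_eq_sq₀ (norm_nonneg _) (norm_nonneg _), ← real_inner_self_eq_norm_sq,
      ← real_inner_self_eq_norm_sq, vec_inner_self, vec_inner_self]
  have hss : ∀ v, rep s (rep s v) = v := by
    intro v
    rw [← orth_mul_apply, hs, rootReflection_mul_self]
    rfl
  set p' := f.symm (s.1 (f p))
  set q' := f.symm (s.1 (f q))
  have hpq' : p' ≠ q' := fun he => hpq (f.injective (s.1.injective (f.symm.injective he)))
  have hroot : rep s (vec f p - vec f q) = vec f p' - vec f q' := by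
    rw [map_sub, hvec, hvec]
  obtain ⟨w, hw, h1, h2⟩ := exists_upper_bound_edge_of_inner_eq_zero hf (k := k) hn hpq' (by
    rw [← hroot, ← (rep s).inner_map_map, hss, hswap, h])
  refine ⟨w, hw, h1, ?_⟩
  rw [chordNC_le_iff hf hpq'] at h2
  rw [chordNC_le_iff hf hk] at h1
  rw [chordNC_le_iff hf hpq]
  have hback : vec f p - vec f q = rep s (vec f p' - vec f q') := by rw [← hroot, hss]
  have hdiff := rootReflection_apply_sub_mem (vec f k - vec f (k + 1)) (vec f p' - vec f q')
  rw [← hs, ← hback] at hdiff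
  have hdiff' := (Submodule.span_singleton_le_iff_mem _ _).2 h1 hdiff
  have := w.mov.add_mem hdiff' h2
  rwa [sub_add_cancel] at this

/-- An edge of the polygon has an upper bound of rank two with every other reflection. -/
theorem exists_upper_bound_edge (hn : 2 ≤ n) (k : ZMod (2 * n)) (hpq : p ≠ q) :
    ∃ w : NC c, w.rank = 2 ∧ hf.chordNC k (k + 1) ≤ w ∧ hf.chordNC p q ≤ w := by
  by_cases h1 : inner ℝ (vec f k) (vec f p - vec f q) = 0
  · exact exists_upper_bound_edge_of_inner_eq_zero hf hn hpq h1
  by_cases h2 : inner ℝ (vec f (k + 1)) (vec f p - vec f q) = 0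
  · exact exists_upper_bound_edge_of_inner_eq_zero' hf hn hpq h2
  have hk := apart_add_one hn k
  have hdiam : k + 1 ≠ k + 1 + (n : ZMod (2 * n)) := ne_add_natCast (by omega) (by omega) _
  -- Only roots in the plane of `vec f k` and `vec f (k + 1)` remain. The moved space spanned by the
  -- edge and the diameter at `k + 1` is that plane.
  obtain ⟨w, hw, h3, h4⟩ := exists_upper_bound_edge_of_inner_eq_zero hf (k := k) hn hdiam (by
    rw [hf.vec_add, inner_sub_right, inner_neg_right, hf.inner_vec hk]; simp)
  refine ⟨w, hw, h3, ?_⟩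
  rw [chordNC_le_iff hf hk.1] at h3
  rw [chordNC_le_iff hf hdiam, hf.vec_add] at h4
  rw [chordNC_le_iff hf hpq]
  have h5 : vec f (k + 1) ∈ w.mov := by
    convert w.mov.smul_mem (1 / 2 : ℝ) h4 using 1
    module
  have h6 : vec f k ∈ w.mov := by
    have := w.mov.add_mem h3 h5
    rwa [sub_add_cancel] at this
  have hspan : ∀ {a b}, vec f a ∈ w.mov → vec f b ∈ Submodule.span ℝ {vec f a} →
      vec f b ∈ w.mov := fun ha hb => (Submodule.span_singleton_le_iff_mem _ _).2 ha hb
  have hmem : ∀ a, Apart k a ∨ vec f a ∈ w.mov := fun a =>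
    (hf.apart_or_vec_mem k a).imp id (hspan h6)
  have hmem' : ∀ a, Apart (k + 1) a ∨ vec f a ∈ w.mov := fun a =>
    (hf.apart_or_vec_mem (k + 1) a).imp id (hspan h5)
  apply w.mov.sub_mem
  -- Otherwise `p` contributes to neither inner product, and `vec f q` alone would have to be
  -- non-orthogonal to two orthogonal basis vectors.
  · by_contra hp
    have ha := (hmem p).resolve_right hp
    have hb := (hmem' p).resolve_right hp
    rw [inner_sub_right, hf.inner_vec ha, zero_sub, neg_eq_zero] at h1
    rw [inner_sub_right, hf.inner_vec hb, zero_sub, neg_eq_zero] at h2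
    rw [real_inner_comm] at h1 h2
    exact (hf.inner_eq_zero_or hk q).elim h1 h2
  · by_contra hq
    have ha := (hmem q).resolve_right hq
    have hb := (hmem' q).resolve_right hq
    rw [inner_sub_right, hf.inner_vec ha, sub_zero] at h1
    rw [inner_sub_right, hf.inner_vec hb, sub_zero] at h2
    rw [real_inner_comm] at h1 h2
    exact (hf.inner_eq_zero_or hk p).elim h1 h2

/-- A diameter and a chord that crosses it at the next vertex have no upper bound of rank two. -/
theorem not_exists_upper_bound (k : ZMod (2 * n)) {m : ℕ} (hm : 2 ≤ m) (hmn : m < n) :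
    ¬∃ w : NC c, w.rank = 2 ∧ hf.chordNC (k + 1) (k + 1 + n) ≤ w ∧
      hf.chordNC k (k + m) ≤ w := by
  rintro ⟨w, hw, h1, h2⟩
  have hdiam : k + 1 ≠ k + 1 + (n : ZMod (2 * n)) := ne_add_natCast (by omega) (by omega) _
  have hkm : k ≠ k + (m : ZMod (2 * n)) := ne_add_natCast (by omega) (by omega) _
  have hinner : ∀ i j : ℕ, i < j + n → j < i + n →
      inner ℝ (vec f (k + i)) (vec f (k + j)) = if i = j then 1 else 0 :=
    fun i j h h' => hf.inner_vec_add k h h'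
  have ap01 : Apart k (k + 1) := apart_add_one (by omega) k
  have ap0m : Apart k (k + (m : ZMod (2 * n))) := by
    simpa using apart_add k (i := 0) (j := m) (by omega) (by omega)
  have ap1m : Apart (k + 1) (k + (m : ZMod (2 * n))) := by
    simpa using apart_add k (i := 1) (j := m) (by omega) (by omega)
  set a := vec f k - vec f (k + m)
  have ha0 : a ≠ 0 := vec_sub_ne_zero hkm
  have hne : hf.chordNC (k + 1) (k + 1 + n) ≠ hf.chordNC k (k + m) := by
    apply chordNC_ne hf hdiam hkm (v := vec f k)
    · rw [hf.vec_add, inner_sub_left, inner_neg_left, hf.inner_vec ap01.symm]; simp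
    · rw [inner_sub_left, vec_inner_self, hf.inner_vec ap0m.symm]; simp
  have hspan := fun v hv => mov_subset_span hf hw hdiam hkm hne h1 h2 (v := v) hv
  -- The preimage of the chord root under `1 - c`: the sum telescopes.
  set v := ∑ j ∈ Finset.range m, vec f (k + (j : ZMod (2 * n))) with hv
  have hv1 : ∀ i : ℕ, i ≤ m → inner ℝ v (vec f (k + i)) = if i < m then 1 else 0 := by
    intro i hi
    rw [hv, sum_inner]
    rw [Finset.sum_congr rfl fun j hj => hinner j i
      (by rw [Finset.mem_range] at hj; omega) (by rw [Finset.mem_range] at hj; omega)]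
    simp
  have hcv : v - rep c v = a := by
    have h3 : rep c v = ∑ j ∈ Finset.range m, vec f (k + ((j + 1 : ℕ) : ZMod (2 * n))) := by
      rw [hv, map_sum]
      apply Finset.sum_congr rfl
      intro j _
      rw [hf.rep_vec, Nat.cast_add, Nat.cast_one, add_assoc]
    rw [h3, hv, ← Finset.sum_sub_distrib,
      Finset.sum_range_sub' (fun j : ℕ => vec f (k + (j : ZMod (2 * n)))) m]
    simp [a]
  have hwv : rep w.1 v = rep c v := by
    apply w.orthLE.apply_eq_of_sub_mem
    rw [chordNC_le_iff hf hkm] at h2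
    rw [← neg_sub, hcv]
    exact neg_mem h2
  have htv : rootReflection a v = rep c v := by
    rw [← hcv]
    exact Submodule.reflection_sub ((rep c).norm_map v).symm
  have hle := NC.le_iff.1 h2
  set t := chord f k (k + m)
  have ht : rep t = rootReflection a := rep_chord hkm
  change OrthLE (rep t) (rep w.1) at hle
  -- Both `w` and the chord reflection `t` send `v` to `c v`, so the rank-one element `t⁻¹ * w.1`
  -- fixes `v`. Its root `g` is thus orthogonal to `v` and lies in the moved space of `w`.
  have hrank : movRank (rep (t⁻¹ * w.1)) = 1 := by
    have h3 := hle
    rw [OrthLE, ht, movRank_rootReflection ha0, ← ht, ← map_inv, ← map_mul] at h3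
    unfold NC.rank at hw
    omega
  obtain ⟨x, hx⟩ := exists_apply_ne (w := t⁻¹ * w.1) (by omega)
  set g := signedVec ((t⁻¹ * w.1).1 x) - signedVec x with hg
  have hg0 : g ≠ 0 := signedVec_sub_ne_zero hx
  have hgm : g ∈ movSpace (rep (t⁻¹ * w.1)) := by
    rw [hg, ← rep_signedVec]
    exact sub_mem_movSpace _ _
  have hfix : v ∈ fixSpace (rep (t⁻¹ * w.1)) := by
    rw [map_mul, map_inv, orth_mem_fixSpace_inv_mul, ht, hwv, htv]
  have horth := inner_eq_zero_of_mem hfix hgm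
  have hgw : g ∈ w.mov := by
    have h3 := hle.movSpace_eq_sup
    rw [← map_inv, ← map_mul] at h3
    unfold NC.mov
    rw [h3]
    exact Submodule.mem_sup_right hgm
  obtain ⟨X, Y, hXY⟩ := hspan g hgw
  have hg' : g = vec f (f.symm ((t⁻¹ * w.1).1 x)) - vec f (f.symm x) := by
    rw [vec, vec, Equiv.apply_symm_apply, Equiv.apply_symm_apply]
  have hcoord := hf.root_inner_eq_zero_or ap01 ap0m ap1m
    (f.symm ((t⁻¹ * w.1).1 x)) (f.symm x)
  rw [← hg', hXY, hf.vec_add] at hcoord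
  rw [hXY, hf.vec_add] at horth
  have i0 := hv1 0 (by omega)
  have i1 := hv1 1 (by omega)
  have im := hv1 m le_rfl
  simp only [Nat.cast_zero, add_zero, Nat.cast_one, lt_irrefl, if_false,
    if_pos (show 0 < m by omega), if_pos (show 1 < m by omega)] at i0 i1 im
  simp only [inner_add_left, inner_sub_left, inner_smul_left, inner_neg_left, vec_inner_self,
    hf.inner_vec ap01, hf.inner_vec ap0m, hf.inner_vec ap1m, hf.inner_vec ap01.symm,
    hf.inner_vec ap0m.symm, hf.inner_vec ap1m.symm, RCLike.conj_to_real] at hcoord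
  simp only [inner_add_right, inner_sub_right, inner_smul_right, inner_neg_right, i0, i1, im]
    at horth
  -- The coordinates of `g` at `k`, `k + 1`, `k + m` are `Y`, `2X`, `-Y`. Orthogonality to `v` says
  -- `2X + Y = 0`, and a root has a zero among three coordinates, so both coefficients vanish.
  have hX : X = 0 := by
    rcases hcoord with h | h | h <;> linarith
  have hY : Y = 0 := by
    rcases hcoord with h | h | h <;> linarith
  rw [hX, zero_smul, hY, zero_smul, add_zero] at hXY
  exact hg0 hXY

/-- The edges are the atoms that have an upper bound of rank two with every atom. -/
theorem exists_eq_edge (hn : 3 ≤ n) {a : NC c} (ha : a.rank = 1)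
    (h : ∀ b : NC c, b.rank = 1 → ∃ w : NC c, w.rank = 2 ∧ a ≤ w ∧ b ≤ w) :
    ∃ k, a = hf.chordNC k (k + 1) := by
  obtain ⟨p, q, hpq, rfl⟩ := exists_eq_chordNC hf ha
  obtain ⟨k, m, hm, hmn, he⟩ := chordNC_normal_form hf hpq
  rw [he] at h ⊢
  rcases Nat.lt_or_ge 1 m with h1 | h1
  · exfalso
    rcases Nat.lt_or_ge m n with h2 | h2
    · obtain ⟨w, hw, hw1, hw2⟩ := h (hf.chordNC (k + 1) (k + 1 + n))
        (chordNC_rank hf (ne_add_natCast (by omega) (by omega) _))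
      exact not_exists_upper_bound hf k h1 h2 ⟨w, hw, hw2, hw1⟩
    · obtain rfl : m = n := by omega
      -- A diameter is excluded by the chord joining the two neighbours of its vertex `k`; this
      -- chord has length `2 < n`.
      obtain ⟨w, hw, hw1, hw2⟩ := h (hf.chordNC (k - 1) (k - 1 + (2 : ℕ)))
        (chordNC_rank hf (ne_add_natCast (by omega) (by omega) _))
      refine not_exists_upper_bound hf (k - 1) (m := 2) le_rfl (by omega) ⟨w, hw, ?_, hw2⟩
      rwa [sub_add_cancel]
  · obtain rfl : m = 1 := by omega
    exact ⟨k, by rw [Nat.cast_one]⟩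

theorem edge_add (hn : 2 ≤ n) (k : ZMod (2 * n)) :
    hf.chordNC (k + n) (k + n + 1) = hf.chordNC k (k + 1) := by
  rw [← chordNC_add hf (ne_add_one hn k), add_right_comm]

theorem edge_apart (hn : 2 ≤ n)
    (h : hf.chordNC k (k + 1) ≠ hf.chordNC l (l + 1)) : Apart k l := by
  by_contra h'
  rcases eq_or_eq_of_not_apart h' with rfl | rfl
  · exact h rfl
  · exact h (edge_add hf hn l)

/-- Two edges whose upper bound of rank two lies above a third atom are adjacent. -/
theorem edge_adjacent (hn : 2 ≤ n) {w d : NC c} (hw : w.rank = 2)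
    (hne : hf.chordNC k (k + 1) ≠ hf.chordNC l (l + 1))
    (hk : hf.chordNC k (k + 1) ≤ w) (hl : hf.chordNC l (l + 1) ≤ w) (hd : d.rank = 1)
    (hdw : d ≤ w) (hdk : d ≠ hf.chordNC k (k + 1)) (hdl : d ≠ hf.chordNC l (l + 1)) :
    hf.chordNC l (l + 1) = hf.chordNC (k + 1) (k + 1 + 1) ∨
      hf.chordNC l (l + 1) = hf.chordNC (k - 1) (k - 1 + 1) := by
  by_contra! hadj
  have h00 := edge_apart hf hn hne
  have h11 : Apart (k + 1) (l + 1) := h00.add_right 1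
  have h01 : Apart k (l + 1) := by
    simpa using ((edge_apart hf hn hadj.2).add_right 1).symm
  have h10 := (edge_apart hf hn hadj.1).symm
  have hk1 := apart_add_one hn k
  obtain ⟨p, q, hpq, rfl⟩ := exists_eq_chordNC hf hd
  rw [chordNC_le_iff hf hpq] at hdw
  obtain ⟨X, Y, hXY⟩ := mov_subset_span hf hw (ne_add_one hn k) (ne_add_one hn l) hne hk hl hdw
  -- Without adjacency the four endpoints lie on distinct diameters. The coordinates at `k`, `k +
  -- 1`, `l` are `X`, `-X`, `Y`, and one of them vanishes.
  have hcoord := hf.root_inner_eq_zero_or hk1 h00 h10 p q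
  rw [hXY] at hcoord
  simp only [inner_add_left, inner_sub_left, inner_smul_left, vec_inner_self,
    hf.inner_vec h00, hf.inner_vec h10, hf.inner_vec hk1,
    hf.inner_vec h00.symm, hf.inner_vec h11.symm, hf.inner_vec h01.symm, hf.inner_vec h10.symm,
    hf.inner_vec hk1.symm, hf.inner_vec (apart_add_one hn l).symm, RCLike.conj_to_real] at hcoord
  have hor : X = 0 ∨ Y = 0 := by
    rcases hcoord with h | h | h
    · left; linarith
    · left; linarith
    · right; linarith
  rcases hor with rfl | rfl
  · rw [zero_smul, zero_add] at hXY
    exact hdl (chordNC_eq_of_smul hf hpq (ne_add_one hn l) hXY)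
  · rw [zero_smul, add_zero] at hXY
    exact hdk (chordNC_eq_of_smul hf hpq (ne_add_one hn k) hXY)

/-- The atoms below the upper bound of two chords that share a vertex. -/
theorem eq_of_le_of_chain (hpk : Apart p k) (hkq : Apart k q) (hpq : Apart p q) {w d : NC c}
    (hw : w.rank = 2) (h1 : hf.chordNC p k ≤ w) (h2 : hf.chordNC k q ≤ w) (hd : d.rank = 1)
    (hdw : d ≤ w) : d = hf.chordNC p k ∨ d = hf.chordNC k q ∨ d = hf.chordNC p q := by
  obtain ⟨a, b, hab, rfl⟩ := exists_eq_chordNC hf hd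
  rw [chordNC_le_iff hf hab] at hdw
  have hne : hf.chordNC p k ≠ hf.chordNC k q := by
    apply chordNC_ne hf hpk.1 hkq.1 (v := vec f q)
    · rw [inner_sub_left, hf.inner_vec hpq, hf.inner_vec hkq, sub_self]
    · rw [inner_sub_left, hf.inner_vec hkq, vec_inner_self]; norm_num
  obtain ⟨X, Y, hXY⟩ := mov_subset_span hf hw hpk.1 hkq.1 hne h1 h2 hdw
  have hcoord := hf.root_inner_eq_zero_or hpk hpq hkq a b
  rw [hXY] at hcoord
  simp only [inner_add_left, inner_sub_left, inner_smul_left, vec_inner_self,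
    hf.inner_vec hpk, hf.inner_vec hkq, hf.inner_vec hpq, hf.inner_vec hpk.symm,
    hf.inner_vec hkq.symm, hf.inner_vec hpq.symm, RCLike.conj_to_real] at hcoord
  -- The coordinates at `p`, `k`, `q` are `X`, `Y - X`, `-Y`; each vanishing leaves one of the three
  -- chords.
  rcases hcoord with h | h | h
  · obtain rfl : X = 0 := by linarith
    rw [zero_smul, zero_add] at hXY
    exact Or.inr (Or.inl (chordNC_eq_of_smul hf hab hkq.1 hXY))
  · obtain rfl : X = Y := by linarith
    refine Or.inr (Or.inr (chordNC_eq_of_smul hf hab hpq.1 (r := X) ?_))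
    rw [hXY]; module
  · obtain rfl : Y = 0 := by linarith
    rw [zero_smul, add_zero] at hXY
    exact Or.inl (chordNC_eq_of_smul hf hab hpk.1 hXY)

end TypeB

/-! ### Automorphisms are determined by their action on the edges. -/

namespace TypeB

open Module

variable {n : ℕ}

theorem apart_add_two (hn : 3 ≤ n) (k : ZMod (2 * n)) : Apart k (k + 1 + 1) := by
  have := apart_add k (i := 0) (j := 2) (by omega) (by omega)
  rw [Nat.cast_zero, add_zero] at this
  have h2 : k + 1 + 1 = k + ((2 : ℕ) : ZMod (2 * n)) := by push_cast; ring
  rwa [h2]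

variable [NeZero n] {c : W n} {f : ZMod (2 * n) ≃ SignedIndex n}
variable (hf : IsPolygonLabelling c f)

theorem edge_ne_edge_add_one (hn : 3 ≤ n) (k : ZMod (2 * n)) :
    hf.chordNC k (k + 1) ≠ hf.chordNC (k + 1) (k + 1 + 1) := by
  have h1 := apart_add_one (by omega : 2 ≤ n) (k + 1)
  apply chordNC_ne hf (ne_add_one (by omega) k) h1.1 (v := vec f (k + 1 + 1))
  · rw [inner_sub_left, hf.inner_vec (apart_add_two hn k), hf.inner_vec h1, sub_self]
  · rw [inner_sub_left, hf.inner_vec h1, vec_inner_self]; norm_num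

theorem edge_ne_edge_add_two (hn : 3 ≤ n) (k : ZMod (2 * n)) :
    hf.chordNC (k + 1 + 1) (k + 1 + 1 + 1) ≠ hf.chordNC k (k + 1) := by
  have h1 := apart_add_one (by omega : 2 ≤ n) (k + 1)
  apply chordNC_ne hf (ne_add_one (by omega) _) (ne_add_one (by omega) k) (v := vec f (k + 1))
  · rw [inner_sub_left, hf.inner_vec h1.symm, hf.inner_vec (apart_add_two hn (k + 1)).symm,
      sub_self]
  · rw [inner_sub_left, hf.inner_vec (apart_add_one (by omega) k), vec_inner_self]; norm_num

theorem exists_apply_edge_eq (hn : 3 ≤ n) (φ : NC c ≃o NC c) (k : ZMod (2 * n)) :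
    ∃ j, φ (hf.chordNC k (k + 1)) = hf.chordNC j (j + 1) := by
  apply exists_eq_edge hf hn
  · rw [NC.rank_apply, chordNC_rank hf (ne_add_one (by omega) k)]
  · intro b hb
    obtain ⟨p, q, hpq, he⟩ := exists_eq_chordNC hf (a := φ.symm b) (by rw [NC.rank_apply, hb])
    obtain ⟨w, hw, h1, h2⟩ := exists_upper_bound_edge hf (by omega) k hpq
    refine ⟨φ w, by rw [NC.rank_apply, hw], φ.map_rel_iff.2 h1, ?_⟩
    rw [← he] at h2
    have := φ.map_rel_iff.2 h2
    rwa [OrderIso.apply_symm_apply] at this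

/-- Consecutive edges have a rank-two upper bound above the chord that closes their triangle. The
images have the same property, and only adjacent edges do. -/
theorem apply_edge_add_one (hn : 3 ≤ n) (φ : NC c ≃o NC c) {k j : ZMod (2 * n)}
    (h : φ (hf.chordNC k (k + 1)) = hf.chordNC j (j + 1)) :
    φ (hf.chordNC (k + 1) (k + 1 + 1)) = hf.chordNC (j + 1) (j + 1 + 1) ∨
      φ (hf.chordNC (k + 1) (k + 1 + 1)) = hf.chordNC (j - 1) (j - 1 + 1) := by
  obtain ⟨l, hl⟩ := exists_apply_edge_eq hf hn φ (k + 1)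
  have a0 := apart_add_one (by omega : 2 ≤ n) k
  have a1 := apart_add_one (by omega : 2 ≤ n) (k + 1)
  have a2 := apart_add_two hn k
  obtain ⟨w, hw, h1, h2⟩ := exists_upper_bound_edge hf (by omega) k a1.1
  have h3 : hf.chordNC k (k + 1 + 1) ≤ w := by
    rw [chordNC_le_iff hf a0.1] at h1
    rw [chordNC_le_iff hf a1.1] at h2
    rw [chordNC_le_iff hf a2.1]
    have := w.mov.add_mem h1 h2
    rwa [sub_add_sub_cancel] at this
  rw [hl]
  apply edge_adjacent hf (by omega) (w := φ w) (d := φ (hf.chordNC k (k + 1 + 1)))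
  · rw [NC.rank_apply, hw]
  · rw [← h, ← hl]
    exact fun he => edge_ne_edge_add_one hf hn k (φ.injective he)
  · rw [← h]; exact φ.map_rel_iff.2 h1
  · rw [← hl]; exact φ.map_rel_iff.2 h2
  · rw [NC.rank_apply, chordNC_rank hf a2.1]
  · exact φ.map_rel_iff.2 h3
  · rw [← h]
    refine fun he => chordNC_ne hf a2.1 a0.1 (v := vec f (k + 1)) ?_ ?_ (φ.injective he)
    · rw [inner_sub_left, hf.inner_vec a0, hf.inner_vec a1.symm, sub_self]
    · rw [inner_sub_left, hf.inner_vec a0, vec_inner_self]; norm_num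
  · rw [← hl]
    refine fun he => chordNC_ne hf a2.1 a1.1 (v := vec f (k + 1)) ?_ ?_ (φ.injective he)
    · rw [inner_sub_left, hf.inner_vec a0, hf.inner_vec a1.symm, sub_self]
    · rw [inner_sub_left, hf.inner_vec a1.symm, vec_inner_self]; norm_num

/-- An automorphism acts on the edges as a rotation or as a reflection. -/
theorem apply_edge_classification (hn : 3 ≤ n) (φ : NC c ≃o NC c) : ∃ a,
    (∀ k, φ (hf.chordNC k (k + 1)) = hf.chordNC (k + a) (k + a + 1)) ∨
      ∀ k, φ (hf.chordNC k (k + 1)) = hf.chordNC (a - k) (a - k + 1) := by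
  obtain ⟨a, ha⟩ := exists_apply_edge_eq hf hn φ 0
  refine ⟨a, ?_⟩
  rcases apply_edge_add_one hf hn φ ha with h | h
  · left
    -- Two consecutive edges are carried through the induction: turning back would give the edges at
    -- `k` and `k + 2` the same image.
    have key : ∀ k, φ (hf.chordNC k (k + 1)) = hf.chordNC (k + a) (k + a + 1) ∧
        φ (hf.chordNC (k + 1) (k + 1 + 1)) = hf.chordNC (k + 1 + a) (k + 1 + a + 1) := by
      intro k
      induction k using zmod_induction with
      | h0 => rw [zero_add a, ha, h, zero_add, add_comm a 1]; exact ⟨rfl, rfl⟩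
      | h1 k ih =>
        refine ⟨ih.2, ?_⟩
        rcases apply_edge_add_one hf hn φ ih.2 with h' | h'
        · rw [h', add_right_comm (k + 1) a 1]
        · exfalso
          have e : k + 1 + a - 1 = k + a := by ring
          rw [e, ← ih.1] at h'
          exact edge_ne_edge_add_two hf hn k (φ.injective h')
    exact fun k => (key k).1
  · right
    have key : ∀ k, φ (hf.chordNC k (k + 1)) = hf.chordNC (a - k) (a - k + 1) ∧
        φ (hf.chordNC (k + 1) (k + 1 + 1)) = hf.chordNC (a - (k + 1)) (a - (k + 1) + 1) := by
      intro k
      induction k using zmod_induction with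
      | h0 => rw [sub_zero, ha, h, zero_add]; exact ⟨rfl, rfl⟩
      | h1 k ih =>
        refine ⟨ih.2, ?_⟩
        rcases apply_edge_add_one hf hn φ ih.2 with h' | h'
        · exfalso
          have e : a - (k + 1) + 1 = a - k := by ring
          rw [e, ← ih.1] at h'
          exact edge_ne_edge_add_two hf hn k (φ.injective h')
        · rw [h', sub_sub a (k + 1) 1]
    exact fun k => (key k).1

/-- Induction on `m`: the chord of length `m + 1` is the third atom in the rank-two interval of the
chord of length `m` and the next edge, both of which are fixed. -/
theorem apply_chord_of_fix_edges (hn : 3 ≤ n) (φ : NC c ≃o NC c)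
    (h : ∀ k, φ (hf.chordNC k (k + 1)) = hf.chordNC k (k + 1)) {m : ℕ} (hm : 1 ≤ m) (hmn : m < n)
    (k : ZMod (2 * n)) : φ (hf.chordNC k (k + m)) = hf.chordNC k (k + m) := by
  induction m, hm using Nat.le_induction with
  | base => simpa using h k
  | succ m hm ih =>
    have ih := ih (by omega)
    have a0 : Apart k (k + (m : ZMod (2 * n))) := by
      simpa using apart_add k (i := 0) (j := m) (by omega) (by omega)
    have a1 := apart_add_one (by omega : 2 ≤ n) (k + (m : ZMod (2 * n)))
    have a2 : Apart k (k + (m : ZMod (2 * n)) + 1) := by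
      have := apart_add k (i := 0) (j := m + 1) (by omega) (by omega)
      rwa [Nat.cast_zero, add_zero, Nat.cast_add, Nat.cast_one, ← add_assoc] at this
    rw [Nat.cast_add, Nat.cast_one, ← add_assoc]
    obtain ⟨w, hw, h1, h2⟩ := exists_upper_bound_edge hf (by omega) (k + (m : ZMod (2 * n))) a0.1
    have h3 : hf.chordNC k (k + m + 1) ≤ w := by
      rw [chordNC_le_iff hf a1.1] at h1
      rw [chordNC_le_iff hf a0.1] at h2
      rw [chordNC_le_iff hf a2.1]
      have := w.mov.add_mem h2 h1
      rwa [sub_add_sub_cancel] at this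
    have h1' := φ.map_rel_iff.2 h1
    have h2' := φ.map_rel_iff.2 h2
    rw [h] at h1'
    rw [ih] at h2'
    rcases eq_of_le_of_chain hf a0 a1 a2 (w := φ w) (d := φ (hf.chordNC k (k + m + 1)))
      (by rw [NC.rank_apply, hw]) h2' h1' (by rw [NC.rank_apply, chordNC_rank hf a2.1])
      (φ.map_rel_iff.2 h3) with h4 | h4 | h4
    · exfalso
      rw [← ih] at h4
      refine chordNC_ne hf a0.1 a2.1 (v := vec f (k + m + 1)) ?_ ?_ (φ.injective h4).symm
      · rw [inner_sub_left, hf.inner_vec a2, hf.inner_vec a1, sub_self]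
      · rw [inner_sub_left, hf.inner_vec a2, vec_inner_self]; norm_num
    · exfalso
      rw [← h] at h4
      refine chordNC_ne hf a2.1 a1.1 (v := vec f (k + m)) ?_ ?_ (φ.injective h4)
      · rw [inner_sub_left, hf.inner_vec a0, hf.inner_vec a1.symm, sub_self]
      · rw [inner_sub_left, hf.inner_vec a1.symm, vec_inner_self]; norm_num
    · exact h4

/-- If `φ` fixes the reflections along `k, k + 1` and along `k + 1, k + n`, then it takes the
diameter at `k` or `k + 1` to a reflection whose root is a combination of the vectors at `k` and
`k + 1`. -/
theorem apply_diameter_mem (hn : 3 ≤ n) (φ : NC c ≃o NC c)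
    (h : ∀ k, φ (hf.chordNC k (k + 1)) = hf.chordNC k (k + 1)) (k : ZMod (2 * n))
    {z p q : ZMod (2 * n)} (hz : z = k ∨ z = k + 1) (hpq : p ≠ q)
    (he : φ (hf.chordNC z (z + n)) = hf.chordNC p q) :
    ∃ x y : ℝ, vec f p - vec f q = x • vec f k + y • vec f (k + 1) := by
  have a0 := apart_add_one (by omega : 2 ≤ n) k
  have hk1 : k + 1 ≠ k + (n : ZMod (2 * n)) := by
    have := apart_add k (i := 1) (j := n) (by omega) (by omega)
    rw [Nat.cast_one] at this
    exact this.1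
  have hz' : z ≠ z + (n : ZMod (2 * n)) := ne_add_natCast (by omega) (by omega) _
  -- This chord has length `n - 1`, so it is already fixed. Its root is `vec f (k + 1) + vec f k`,
  -- which together with the edge root spans the plane.
  have hfix : φ (hf.chordNC (k + 1) (k + n)) = hf.chordNC (k + 1) (k + n) := by
    have := apply_chord_of_fix_edges hf hn φ h (m := n - 1) (by omega) (by omega) (k + 1)
    have e : k + 1 + ((n - 1 : ℕ) : ZMod (2 * n)) = k + n := by
      rw [add_assoc, ← Nat.cast_one, ← Nat.cast_add]
      congr 2
      omega
    rwa [e] at this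
  obtain ⟨w, hw, h1, h2⟩ := exists_upper_bound_edge hf (by omega) k hk1
  have h3 : hf.chordNC z (z + n) ≤ w := by
    rw [chordNC_le_iff hf a0.1] at h1
    rw [chordNC_le_iff hf hk1, hf.vec_add] at h2
    rw [chordNC_le_iff hf hz', hf.vec_add]
    rcases hz with rfl | rfl
    · convert w.mov.add_mem h1 h2 using 1
      module
    · convert w.mov.sub_mem h2 h1 using 1
      module
  have h1' := φ.map_rel_iff.2 h1
  have h2' := φ.map_rel_iff.2 h2
  have h3' := φ.map_rel_iff.2 h3
  rw [h] at h1'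
  rw [hfix] at h2'
  rw [he, chordNC_le_iff hf hpq] at h3'
  have hne : hf.chordNC k (k + 1) ≠ hf.chordNC (k + 1) (k + n) := by
    apply chordNC_ne hf a0.1 hk1 (v := vec f k + vec f (k + 1))
    · rw [inner_sub_left, inner_add_right, inner_add_right, vec_inner_self, vec_inner_self,
        hf.inner_vec a0, hf.inner_vec a0.symm]
      norm_num
    · rw [hf.vec_add, inner_sub_left, inner_neg_left, inner_add_right, inner_add_right,
        vec_inner_self, vec_inner_self, hf.inner_vec a0, hf.inner_vec a0.symm]
      norm_num
  obtain ⟨x, y, hxy⟩ := mov_subset_span hf (by rw [NC.rank_apply, hw]) a0.1 hk1 hne h1' h2' h3'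
  refine ⟨x + y, y - x, ?_⟩
  rw [hxy, hf.vec_add]
  module

theorem apply_diameter_of_fix_edges (hn : 3 ≤ n) (φ : NC c ≃o NC c)
    (h : ∀ k, φ (hf.chordNC k (k + 1)) = hf.chordNC k (k + 1)) (k : ZMod (2 * n)) :
    φ (hf.chordNC k (k + n)) = hf.chordNC k (k + n) := by
  have hk : k ≠ k + (n : ZMod (2 * n)) := ne_add_natCast (by omega) (by omega) _
  obtain ⟨p, q, hpq, he⟩ := exists_eq_chordNC hf (a := φ (hf.chordNC k (k + n)))
    (by rw [NC.rank_apply, chordNC_rank hf hk])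
  obtain ⟨x, y, hxy⟩ := apply_diameter_mem hf hn φ h k (Or.inl rfl) hpq he
  obtain ⟨x', y', hxy'⟩ := apply_diameter_mem hf hn φ h (k - 1) (z := k)
    (Or.inr (by ring)) hpq he
  rw [sub_add_cancel] at hxy'
  have a0 := apart_add_one (by omega : 2 ≤ n) k
  have a1 : Apart (k - 1) (k + 1) := by
    have := apart_add_two hn (k - 1)
    rwa [sub_add_cancel] at this
  -- The root of the image lies in the planes of `k, k + 1` and of `k - 1, k`, which meet in the
  -- line of `vec f k`. The factor `x / 2` below arises because the diameter has root `2 • vec f k`.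
  have hy : y = 0 := by
    have := congrArg (fun v => inner ℝ v (vec f (k + 1))) (hxy.symm.trans hxy')
    simp only [inner_add_left, inner_smul_left, hf.inner_vec a0, hf.inner_vec a1, vec_inner_self,
      RCLike.conj_to_real] at this
    linarith
  rw [he]
  apply chordNC_eq_of_smul hf hpq hk (r := x / 2)
  rw [hxy, hy, hf.vec_add]
  module

/-- An automorphism that fixes every edge is the identity. -/
theorem eq_one_of_fix_edges (hn : 3 ≤ n) (φ : NC c ≃o NC c)
    (h : ∀ k, φ (hf.chordNC k (k + 1)) = hf.chordNC k (k + 1)) : φ = 1 := by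
  have hall : ∀ p q, p ≠ q → φ (hf.chordNC p q) = hf.chordNC p q := by
    intro p q hpq
    obtain ⟨k, m, hm, hmn, he⟩ := chordNC_normal_form hf hpq
    rw [he]
    rcases Nat.lt_or_ge m n with hlt | hge
    · exact apply_chord_of_fix_edges hf hn φ h hm hlt k
    · obtain rfl : m = n := by omega
      exact apply_diameter_of_fix_edges hf hn φ h k
  have hiff : ∀ (w : NC c) {p q}, p ≠ q →
      (vec f p - vec f q ∈ (φ w).mov ↔ vec f p - vec f q ∈ w.mov) := by
    intro w p q hpq
    rw [← chordNC_le_iff hf hpq, ← chordNC_le_iff hf hpq]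
    have := φ.map_rel_iff (a := hf.chordNC p q) (b := w)
    rwa [hall p q hpq] at this
  have hroot : ∀ (w : NC c) {x}, w.1.1 x ≠ x →
      signedVec (w.1.1 x) - signedVec x ∈ w.mov := by
    intro w x _
    rw [← rep_signedVec]
    exact sub_mem_movSpace _ _
  have hvec : ∀ x y : SignedIndex n,
      signedVec x - signedVec y = vec f (f.symm x) - vec f (f.symm y) := by
    intro x y
    rw [vec, vec, Equiv.apply_symm_apply, Equiv.apply_symm_apply]
  refine RelIso.ext fun w => ?_
  -- All atoms are fixed, so `w` and its image have the same roots in their moved spaces.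
  apply NC.eq_of_mov_eq
  apply le_antisymm
  · apply movSpace_rep_le
    intro x hx
    have := hroot (φ w) hx
    rw [hvec] at this ⊢
    exact (hiff w fun h => hx (f.symm.injective h)).1 this
  · apply movSpace_rep_le
    intro x hx
    have := hroot w hx
    rw [hvec] at this ⊢
    exact (hiff w fun h => hx (f.symm.injective h)).2 this

end TypeB

/-! ### The action of the polygon symmetries on the non-crossing partitions. -/

namespace TypeB

variable {n : ℕ}

theorem absLength_conj (u w : W n) : absLength (u * w * u⁻¹) = absLength w := by
  rw [absLength_eq, absLength_eq, map_mul, map_mul, map_inv, movRank_conj]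

theorem absLength_inv (w : W n) : absLength w⁻¹ = absLength w := by
  rw [absLength_eq, absLength_eq, map_inv, movRank_inv]

theorem AbsLE.conj {v w : W n} (h : AbsLE v w) (u : W n) :
    AbsLE (u * v * u⁻¹) (u * w * u⁻¹) := by
  have e : (u * v * u⁻¹)⁻¹ * (u * w * u⁻¹) = u * (v⁻¹ * w) * u⁻¹ := by group
  rw [AbsLE, e, absLength_conj, absLength_conj, absLength_conj]
  exact h

theorem AbsLE.inv {v w : W n} (h : AbsLE v w) : AbsLE v⁻¹ w⁻¹ := by
  have e : v⁻¹⁻¹ * w⁻¹ = v * (v⁻¹ * w)⁻¹ * v⁻¹ := by group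
  rw [AbsLE, e, absLength_conj, absLength_inv, absLength_inv, absLength_inv]
  exact h

section Automorphisms

variable {c : W n}

/-- Conjugation by an element that commutes with `c`. -/
def conjAut (u : W n) (h : u * c * u⁻¹ = c) : NC c ≃o NC c where
  toFun w := NC.mk (u * w.1 * u⁻¹) (by simpa only [h] using w.2.conj u)
  invFun w := NC.mk (u⁻¹ * w.1 * u⁻¹⁻¹) (by
    have h' : u⁻¹ * c * u⁻¹⁻¹ = c := by
      conv_lhs => rw [← h]
      group
    simpa only [h'] using w.2.conj u⁻¹)
  left_inv w := Subtype.ext (by simp only [NC.mk]; group)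
  right_inv w := Subtype.ext (by simp only [NC.mk]; group)
  map_rel_iff' := by
    intro v w
    constructor
    · intro hvw
      have := AbsLE.conj (v := u * v.1 * u⁻¹) (w := u * w.1 * u⁻¹) hvw u⁻¹
      have e : ∀ x : W n, u⁻¹ * (u * x * u⁻¹) * u⁻¹⁻¹ = x := fun x => by group
      rwa [e, e] at this
    · exact fun hvw => AbsLE.conj hvw u

/-- Inversion followed by conjugation by an element that conjugates `c⁻¹` to `c`. -/
def conjInvAut (u : W n) (h : u * c⁻¹ * u⁻¹ = c) : NC c ≃o NC c where
  toFun w := NC.mk (u * w.1⁻¹ * u⁻¹) (by simpa only [h] using w.2.inv.conj u)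
  invFun w := NC.mk (u⁻¹ * w.1⁻¹ * u⁻¹⁻¹) (by
    have h' : u⁻¹ * c⁻¹ * u⁻¹⁻¹ = c := by
      conv_lhs => rw [← h]
      group
    simpa only [h'] using w.2.inv.conj u⁻¹)
  left_inv w := Subtype.ext (by simp only [NC.mk]; group)
  right_inv w := Subtype.ext (by simp only [NC.mk]; group)
  map_rel_iff' := by
    intro v w
    constructor
    · intro hvw
      have := (AbsLE.conj (v := u * v.1⁻¹ * u⁻¹) (w := u * w.1⁻¹ * u⁻¹) hvw u⁻¹).inv
      have e : ∀ x : W n, (u⁻¹ * (u * x⁻¹ * u⁻¹) * u⁻¹⁻¹)⁻¹ = x := fun x => by group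
      rwa [e, e] at this
    · exact fun hvw => (AbsLE.inv hvw).conj u

end Automorphisms

theorem polygonAct_one {m : ℕ} (k : ZMod m) : polygonAct 1 k = k := by
  change k + 0 = k
  rw [add_zero]

theorem polygonAct_mul {m : ℕ} (g h : DihedralGroup m) (k : ZMod m) :
    polygonAct (g * h) k = polygonAct g (polygonAct h k) := by
  rcases g with i | i <;> rcases h with j | j
  · change k + (i + j) = k + j + i; ring
  · change -(k + (j - i)) = -(k + j) + i; ring
  · change -(k + (i + j)) = -(k + j + i); ring
  · change k + (j - i) = -(-(k + j) + i); ring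

theorem polygonAct_add_natCast (g : DihedralGroup (2 * n)) (k : ZMod (2 * n)) :
    polygonAct g (k + n) = polygonAct g k + n := by
  rcases g with i | i
  · change k + n + i = k + i + n; ring
  · change -(k + n + i) = -(k + i) + n
    have := add_natCast_self (n := n)
    linear_combination -this

theorem ext_labelling (f : ZMod (2 * n) ≃ SignedIndex n) {u v : W n}
    (h : ∀ k, u.1 (f k) = v.1 (f k)) : u = v :=
  Subtype.ext (Equiv.ext fun x => by
    have := h (f.symm x)
    rwa [Equiv.apply_symm_apply] at this)

/-- The quotient map from the symmetries of the `2n`-gon to the symmetries of the `n`-gon, shifted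
so that the reflection `sr b` goes to `sr 0`. -/
def dihedralQuotient (b : ZMod (2 * n)) : DihedralGroup (2 * n) →* DihedralGroup n where
  toFun
    | DihedralGroup.r i => DihedralGroup.r (ZMod.castHom (dvd_mul_left n 2) (ZMod n) i)
    | DihedralGroup.sr i => DihedralGroup.sr (ZMod.castHom (dvd_mul_left n 2) (ZMod n) (i - b))
  map_one' := by
    change DihedralGroup.r (ZMod.castHom (dvd_mul_left n 2) (ZMod n) 0) = DihedralGroup.r 0
    rw [map_zero]
  map_mul' g h := by
    rcases g with i | i <;> rcases h with j | j
    · simp only [DihedralGroup.r_mul_r, map_add]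
    · simp only [DihedralGroup.r_mul_sr, map_sub]
      congr 1; ring
    · simp only [DihedralGroup.sr_mul_r, map_sub, map_add]
      congr 1; ring
    · simp only [DihedralGroup.sr_mul_sr, map_sub]
      congr 1; ring

theorem dihedralQuotient_sr (b i : ZMod (2 * n)) : dihedralQuotient b (.sr i) =
    .sr (ZMod.castHom (dvd_mul_left n 2) (ZMod n) (i - b)) := rfl

theorem dihedralQuotient_surjective (b : ZMod (2 * n)) :
    Function.Surjective (dihedralQuotient b) := by
  have hs := ZMod.castHom_surjective (dvd_mul_left n 2)
  rintro (i | i)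
  · obtain ⟨j, rfl⟩ := hs i
    exact ⟨.r j, rfl⟩
  · obtain ⟨j, rfl⟩ := hs i
    refine ⟨.sr (j + b), ?_⟩
    rw [dihedralQuotient_sr, add_sub_cancel_right]

variable [NeZero n] {c : W n} {f : ZMod (2 * n) ≃ SignedIndex n}
variable (hf : IsPolygonLabelling c f)

theorem IsPolygonLabelling.symm_flip (hf : IsPolygonLabelling c f) (x : SignedIndex n) :
    f.symm (flip x) = f.symm x + n := by
  rw [Equiv.symm_apply_eq, hf.add_natCast, Equiv.apply_symm_apply]

/-- The symmetries of the polygon as signed permutations. -/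
def polygonHom : DihedralGroup (2 * n) →* W n where
  toFun g := ⟨{ toFun := fun x => f (polygonAct g (f.symm x))
                invFun := fun x => f (polygonAct g⁻¹ (f.symm x))
                left_inv := fun x => by
                  simp only [Equiv.symm_apply_apply]
                  rw [← polygonAct_mul, inv_mul_cancel, polygonAct_one, Equiv.apply_symm_apply]
                right_inv := fun x => by
                  simp only [Equiv.symm_apply_apply]
                  rw [← polygonAct_mul, mul_inv_cancel, polygonAct_one, Equiv.apply_symm_apply] },
    fun x => by
      change f (polygonAct g (f.symm (flip x))) = flip (f (polygonAct g (f.symm x)))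
      rw [hf.symm_flip, polygonAct_add_natCast, hf.add_natCast]⟩
  map_one' := Subtype.ext (Equiv.ext fun x => by
    change f (polygonAct 1 (f.symm x)) = x
    rw [polygonAct_one, Equiv.apply_symm_apply])
  map_mul' g h := Subtype.ext (Equiv.ext fun x => by
    change f (polygonAct (g * h) (f.symm x)) =
      f (polygonAct g (f.symm (f (polygonAct h (f.symm x)))))
    rw [polygonAct_mul, Equiv.symm_apply_apply])

theorem polygonHom_apply (g : DihedralGroup (2 * n)) (k : ZMod (2 * n)) :
    (polygonHom hf g).1 (f k) = f (polygonAct g k) := by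
  change f (polygonAct g (f.symm (f k))) = _
  rw [Equiv.symm_apply_apply]

theorem polygonHom_r_one : polygonHom hf (DihedralGroup.r 1) = c :=
  ext_labelling f fun k => by rw [polygonHom_apply, ← hf]; rfl

theorem polygonHom_conj_r (i : ZMod (2 * n)) :
    polygonHom hf (DihedralGroup.r i) * c * (polygonHom hf (DihedralGroup.r i))⁻¹ = c := by
  have h := polygonHom_r_one hf
  have h2 : DihedralGroup.r i * DihedralGroup.r 1 * (DihedralGroup.r i)⁻¹ =
      DihedralGroup.r (1 : ZMod (2 * n)) := by
    simp
  have h3 := congrArg (polygonHom hf) h2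
  rwa [map_mul, map_mul, map_inv, h] at h3

theorem polygonHom_conj_sr (i : ZMod (2 * n)) :
    polygonHom hf (DihedralGroup.sr i) * c⁻¹ * (polygonHom hf (DihedralGroup.sr i))⁻¹ = c := by
  have h := polygonHom_r_one hf
  have h2 : DihedralGroup.sr i * (DihedralGroup.r 1)⁻¹ * (DihedralGroup.sr i)⁻¹ =
      DihedralGroup.r (1 : ZMod (2 * n)) := by
    simp
  have h3 := congrArg (polygonHom hf) h2
  rwa [map_mul, map_mul, map_inv, map_inv, h] at h3

/-- The action of the symmetries of the polygon on the non-crossing partitions. -/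
def polygonAut : DihedralGroup (2 * n) →* (NC c ≃o NC c) where
  toFun
    | DihedralGroup.r i => conjAut (polygonHom hf (DihedralGroup.r i)) (polygonHom_conj_r hf i)
    | DihedralGroup.sr i =>
      conjInvAut (polygonHom hf (DihedralGroup.sr i)) (polygonHom_conj_sr hf i)
  map_one' := RelIso.ext fun w => Subtype.ext (by
    change polygonHom hf 1 * w.1 * (polygonHom hf 1)⁻¹ = w.1
    simp)
  map_mul' g h := by
    refine RelIso.ext fun w => Subtype.ext ?_
    rcases g with i | i <;> rcases h with j | j
    · change polygonHom hf (.r i * .r j) * w.1 * (polygonHom hf (.r i * .r j))⁻¹ =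
        polygonHom hf (.r i) * (polygonHom hf (.r j) * w.1 * (polygonHom hf (.r j))⁻¹) *
          (polygonHom hf (.r i))⁻¹
      rw [map_mul]; group
    · change polygonHom hf (.r i * .sr j) * w.1⁻¹ * (polygonHom hf (.r i * .sr j))⁻¹ =
        polygonHom hf (.r i) * (polygonHom hf (.sr j) * w.1⁻¹ * (polygonHom hf (.sr j))⁻¹) *
          (polygonHom hf (.r i))⁻¹
      rw [map_mul]; group
    · change polygonHom hf (.sr i * .r j) * w.1⁻¹ * (polygonHom hf (.sr i * .r j))⁻¹ =
        polygonHom hf (.sr i) * (polygonHom hf (.r j) * w.1 * (polygonHom hf (.r j))⁻¹)⁻¹ *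
          (polygonHom hf (.sr i))⁻¹
      rw [map_mul]; group
    · change polygonHom hf (.sr i * .sr j) * w.1 * (polygonHom hf (.sr i * .sr j))⁻¹ =
        polygonHom hf (.sr i) * (polygonHom hf (.sr j) * w.1⁻¹ * (polygonHom hf (.sr j))⁻¹)⁻¹ *
          (polygonHom hf (.sr i))⁻¹
      rw [map_mul]; group

theorem polygonAut_r (i : ZMod (2 * n)) (w : NC c) : (polygonAut hf (.r i) w).1 =
    polygonHom hf (.r i) * w.1 * (polygonHom hf (.r i))⁻¹ := rfl

theorem polygonAut_sr (i : ZMod (2 * n)) (w : NC c) : (polygonAut hf (.sr i) w).1 =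
    polygonHom hf (.sr i) * w.1⁻¹ * (polygonHom hf (.sr i))⁻¹ := rfl

/-- Conjugation transports cycles, and inversion does not change them. -/
theorem sameBlock_polygonAut (g : DihedralGroup (2 * n)) (w : NC c) (x y : ZMod (2 * n)) :
    SameBlock f (polygonAut hf g w).1 (polygonAct g x) (polygonAct g y) ↔
      SameBlock f w.1 x y := by
  unfold SameBlock
  rw [← polygonHom_apply hf, ← polygonHom_apply hf]
  rcases g with i | i
  · rw [polygonAut_r]
    simp only [Subgroup.coe_mul, Subgroup.coe_inv, Equiv.Perm.sameCycle_conj,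
      Equiv.Perm.coe_inv, Equiv.symm_apply_apply]
  · rw [polygonAut_sr]
    simp only [Subgroup.coe_mul, Subgroup.coe_inv, Equiv.Perm.sameCycle_conj,
      Equiv.Perm.coe_inv, Equiv.symm_apply_apply, Equiv.Perm.sameCycle_inv]

/-- Reflections are involutions, so the inversion in the orientation-reversing case has no effect on
atoms. -/
theorem polygonAut_chordNC (g : DihedralGroup (2 * n)) {p q : ZMod (2 * n)} (h : p ≠ q) :
    polygonAut hf g (hf.chordNC p q) = hf.chordNC (polygonAct g p) (polygonAct g q) := by
  have hpq : polygonAct g p ≠ polygonAct g q := by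
    intro he
    rw [← f.injective.eq_iff, ← polygonHom_apply hf, ← polygonHom_apply hf] at he
    exact h (f.injective ((polygonHom hf g).1.injective he))
  have hroot : rep (polygonHom hf g) (vec f p - vec f q) =
      vec f (polygonAct g p) - vec f (polygonAct g q) := by
    simp only [vec, map_sub, rep_signedVec, polygonHom_apply]
  refine Subtype.ext (rep_injective ?_)
  change rep (polygonAut hf g (hf.chordNC p q)).1 = rep (chord f _ _)
  rw [rep_chord hpq, ← hroot, ← rootReflection_conj, ← rep_chord h]
  rcases g with i | i
  · rw [polygonAut_r, map_mul, map_mul, map_inv]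
    rfl
  · rw [polygonAut_sr, map_mul, map_mul, map_inv, map_inv]
    change _ * (rep (chord f p q))⁻¹ * _ = _
    rw [rep_chord h, rootReflection_inv]

theorem polygonAut_surjective (hn : 3 ≤ n) : Function.Surjective (polygonAut hf) := by
  intro φ
  have key : ∀ g, (∀ k, φ (hf.chordNC k (k + 1)) = polygonAut hf g (hf.chordNC k (k + 1))) →
      polygonAut hf g = φ := by
    intro g hg
    have h1 : (polygonAut hf g)⁻¹ * φ = 1 := by
      apply eq_one_of_fix_edges hf hn
      intro k
      rw [RelIso.mul_apply, hg, ← RelIso.mul_apply, inv_mul_cancel]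
      rfl
    exact inv_mul_eq_one.1 h1
  obtain ⟨a, h | h⟩ := apply_edge_classification hf hn φ
  · refine ⟨.r a, key _ fun k => ?_⟩
    rw [h, polygonAut_chordNC hf _ (ne_add_one (by omega) k)]
    change _ = hf.chordNC (k + a) (k + 1 + a)
    rw [add_right_comm]
  -- A reflection exchanges the ends of an edge: `k` must go to `a - k + 1` and `k + 1` to `a - k`,
  -- which forces this index.
  · refine ⟨.sr (-a - 1), key _ fun k => ?_⟩
    rw [h, polygonAut_chordNC hf _ (ne_add_one (by omega) k)]
    change _ = hf.chordNC (-(k + (-a - 1))) (-(k + 1 + (-a - 1)))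
    have e1 : -(k + (-a - 1)) = a - k + 1 := by ring
    have e2 : -(k + 1 + (-a - 1)) = a - k := by ring
    rw [e1, e2, chordNC_comm hf (ne_add_one (by omega) _)]

theorem not_apart_of_diameter_eq {a b : ZMod (2 * n)}
    (h : hf.chordNC a (a + n) = hf.chordNC b (b + n)) : ¬Apart a b := by
  intro hab
  have hpos := Nat.pos_of_neZero n
  have hne : ∀ z : ZMod (2 * n), z ≠ z + n := fun z => ne_add_natCast hpos (by omega) z
  refine chordNC_ne hf (hne a) (hne b) (v := vec f b) ?_ ?_ h
  · rw [hf.vec_add, inner_sub_left, inner_neg_left, hf.inner_vec hab]; simp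
  · rw [hf.vec_add, inner_sub_left, inner_neg_left, vec_inner_self]; norm_num

/-- A kernel element preserves every diameter. For a rotation this leaves the identity and the half
turn; a reflection preserving the diameters at `0` and `1` would give `2 = 0` modulo `n`, excluded
by `3 ≤ n`. -/
theorem polygonAut_ker (hn : 3 ≤ n) :
    (polygonAut hf).ker = Subgroup.zpowers (DihedralGroup.r (n : ZMod (2 * n))) := by
  apply le_antisymm
  · intro g hg
    rw [MonoidHom.mem_ker] at hg
    have hdiam : ∀ k, ¬Apart (polygonAct g k) k := by
      intro k
      apply not_apart_of_diameter_eq hf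
      rw [← polygonAct_add_natCast,
        ← polygonAut_chordNC hf g (ne_add_natCast (by omega) (by omega) k), hg]
      rfl
    rcases g with i | i
    · have h0 := eq_or_eq_of_not_apart (hdiam 0)
      change 0 + i = 0 ∨ 0 + i = 0 + n at h0
      rw [zero_add, zero_add] at h0
      rcases h0 with rfl | rfl
      · exact Subgroup.one_mem _
      · exact Subgroup.mem_zpowers _
    · exfalso
      have h0 := eq_or_eq_of_not_apart (hdiam 0)
      have h1 := eq_or_eq_of_not_apart (hdiam 1)
      change -(0 + i) = 0 ∨ -(0 + i) = 0 + n at h0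
      change -(1 + i) = 1 ∨ -(1 + i) = 1 + n at h1
      have h2 := apart_add_two hn (0 : ZMod (2 * n))
      have hnn := add_natCast_self (n := n)
      rcases h0 with h0 | h0 <;> rcases h1 with h1 | h1
      · exact h2.1 (by linear_combination h1 - h0)
      · exact h2.2 (by linear_combination h1 - h0)
      · exact h2.2 (by linear_combination h1 - h0 - hnn)
      · exact h2.1 (by linear_combination h1 - h0)
  · rw [Subgroup.zpowers_le, MonoidHom.mem_ker]
    -- The half turn acts as the sign change, which commutes with every signed permutation by
    -- definition.
    have hcentral : ∀ w : W n, polygonHom hf (.r (n : ZMod (2 * n))) * w =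
        w * polygonHom hf (.r (n : ZMod (2 * n))) := by
      have hflip : ∀ x, (polygonHom hf (.r (n : ZMod (2 * n)))).1 x = flip x := by
        intro x
        rw [← f.apply_symm_apply x, polygonHom_apply, ← hf.add_natCast]
        rfl
      intro w
      refine Subtype.ext (Equiv.ext fun x => ?_)
      change (polygonHom hf (.r (n : ZMod (2 * n)))).1 (w.1 x) =
        w.1 ((polygonHom hf (.r (n : ZMod (2 * n)))).1 x)
      rw [hflip, hflip, apply_flip]
    refine RelIso.ext fun w => Subtype.ext ?_
    rw [polygonAut_r, hcentral, mul_inv_cancel_right]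
    rfl

/-! ### Generation by adjacent reflections, the dihedral quotient and bipartitions. -/

theorem closure_sr_eq_top {m : ℕ} (b : ZMod m) :
    Subgroup.closure {DihedralGroup.sr b, DihedralGroup.sr (b + 1)} = ⊤ := by
  rw [eq_top_iff]
  intro g _
  set H := Subgroup.closure {DihedralGroup.sr b, DihedralGroup.sr (b + 1)}
  have h0 : DihedralGroup.sr b ∈ H := Subgroup.subset_closure (by simp)
  have h1 : DihedralGroup.sr (b + 1) ∈ H := Subgroup.subset_closure (by simp)
  have hr1 : DihedralGroup.r (1 : ZMod m) ∈ H := by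
    have := H.mul_mem h0 h1
    rwa [DihedralGroup.sr_mul_sr, add_sub_cancel_left] at this
  have hr : ∀ i : ZMod m, DihedralGroup.r i ∈ H := by
    intro i
    obtain ⟨j, rfl⟩ := ZMod.intCast_surjective i
    rw [← DihedralGroup.r_one_zpow]
    exact H.zpow_mem hr1 j
  rcases g with i | i
  · exact hr i
  · have := H.mul_mem h0 (hr (i - b))
    rwa [DihedralGroup.sr_mul_r, add_sub_cancel] at this

theorem dihedralQuotient_ker (b : ZMod (2 * n)) :
    (dihedralQuotient b).ker = Subgroup.zpowers (DihedralGroup.r (n : ZMod (2 * n))) := by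
  apply le_antisymm
  · intro g hg
    rw [MonoidHom.mem_ker] at hg
    rcases g with i | i
    · have h0 : ZMod.castHom (dvd_mul_left n 2) (ZMod n) i = 0 := DihedralGroup.r.inj hg
      obtain ⟨j, hj, rfl⟩ : ∃ j : ℕ, j < 2 * n ∧ (j : ZMod (2 * n)) = i :=
        ⟨i.val, ZMod.val_lt i, ZMod.natCast_zmod_val i⟩
      rw [map_natCast, ZMod.natCast_eq_zero_iff] at h0
      obtain ⟨q, rfl⟩ := h0
      have hq : q < 2 := by
        by_contra hge
        have := Nat.mul_le_mul_left n (not_lt.1 hge)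
        omega
      interval_cases q
      · rw [mul_zero, Nat.cast_zero]; exact Subgroup.one_mem _
      · rw [mul_one]; exact Subgroup.mem_zpowers _
    · rw [dihedralQuotient_sr, DihedralGroup.one_def] at hg
      exact absurd hg (by rintro ⟨⟩)
  · rw [Subgroup.zpowers_le, MonoidHom.mem_ker]
    change DihedralGroup.r (ZMod.castHom (dvd_mul_left n 2) (ZMod n) n) = DihedralGroup.r 0
    rw [map_natCast, ZMod.natCast_self]

theorem exists_mulEquiv_of_ker_eq {G H K : Type*} [Group G] [Group H] [Group K] (α : G →* H)
    (β : G →* K) (hα : Function.Surjective α) (hβ : Function.Surjective β) (h : α.ker = β.ker) :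
    ∃ e : H ≃* K, ∀ g, e (α g) = β g := by
  refine ⟨(QuotientGroup.quotientKerEquivOfSurjective α hα).symm.trans
    ((QuotientGroup.quotientMulEquivOfEq h).trans
      (QuotientGroup.quotientKerEquivOfSurjective β hβ)), fun g => ?_⟩
  have h1 : (QuotientGroup.quotientKerEquivOfSurjective α hα).symm (α g) = (g : G ⧸ α.ker) := by
    rw [MulEquiv.symm_apply_eq]
    rfl
  rw [MulEquiv.trans_apply, h1]
  rfl

theorem eq_polygonHom_of_isBipartition {l r : W n} (h : IsBipartition c l r) :
    ∃ b, l = polygonHom hf (.sr b) ∧ r = polygonHom hf (.sr (b + 1)) := by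
  obtain ⟨hc, hl, hr⟩ := h
  have hrev : ∀ x, c.1 (l.1 (c.1 x)) = l.1 x := by
    intro x
    have : c * l * c = l := by
      rw [pow_two] at hl hr
      rw [hc]
      calc l * r * l * (l * r) = l * r * (l * l) * r := by group
        _ = l * (r * r) := by rw [hl]; group
        _ = l := by rw [hr, mul_one]
    exact congrArg (fun w : W n => w.1 x) this
  -- Since `c l c = l`, the factor `l` is a polygon reflection; `sr b` sends vertex `0` to `-b`,
  -- which determines the index.
  have hl' : l = polygonHom hf (.sr (-f.symm (l.1 (f 0)))) :=
    ext_labelling f fun k => by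
      rw [hf.apply_of_reverse hrev, polygonHom_apply]
      change _ = f (-(k + -f.symm (l.1 (f 0))))
      congr 1
      ring
  refine ⟨-f.symm (l.1 (f 0)), hl', ?_⟩
  have hr' : r = l * c := by rw [hc, ← mul_assoc, ← pow_two, hl, one_mul]
  rw [← DihedralGroup.sr_mul_r, map_mul, polygonHom_r_one, ← hl', hr']

theorem exists_isBipartition (hf : IsPolygonLabelling c f) : ∃ l r : W n, IsBipartition c l r := by
  have hsq : ∀ i, polygonHom hf (.sr i) ^ 2 = 1 := by
    intro i
    rw [← map_pow, pow_two, DihedralGroup.sr_mul_self, map_one]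
  refine ⟨polygonHom hf (.sr 0), polygonHom hf (.sr 1), ?_, hsq _, hsq _⟩
  rw [← map_mul, DihedralGroup.sr_mul_sr, sub_zero, polygonHom_r_one]

end TypeB

theorem mainTheorem2 (n : ℕ) (hn : 3 ≤ n) (c : TypeB.W n) (hc : TypeB.IsCoxeterElement c) :
    (∃ l r : TypeB.W n, TypeB.IsBipartition c l r) ∧
    (∀ l r : TypeB.W n, TypeB.IsBipartition c l r →
      ∃ φl φr : TypeB.NC c ≃o TypeB.NC c,
        (∀ w, (φl w).1 = l * w.1⁻¹ * l) ∧
        (∀ w, (φr w).1 = r * w.1⁻¹ * r) ∧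
        Subgroup.closure {φl, φr} = ⊤ ∧
        ∃ e : (TypeB.NC c ≃o TypeB.NC c) ≃* DihedralGroup n,
          e φl = DihedralGroup.sr 0 ∧ e φr = DihedralGroup.sr 1) ∧
    Nat.card (TypeB.NC c ≃o TypeB.NC c) = 2 * n ∧
    (∃ f : ZMod (2 * n) ≃ TypeB.SignedIndex n, TypeB.IsPolygonLabelling c f) ∧
    (∀ f : ZMod (2 * n) ≃ TypeB.SignedIndex n, TypeB.IsPolygonLabelling c f →
      ∃ ρ : DihedralGroup (2 * n) →* (TypeB.NC c ≃o TypeB.NC c),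
        Function.Surjective ρ ∧
        ρ.ker = Subgroup.zpowers (DihedralGroup.r (n : ZMod (2 * n))) ∧
        ∀ (g : DihedralGroup (2 * n)) (w : TypeB.NC c) (x y : ZMod (2 * n)),
          TypeB.SameBlock f (ρ g w).1 (TypeB.polygonAct g x) (TypeB.polygonAct g y) ↔
            TypeB.SameBlock f w.1 x y) := by
  have : NeZero n := ⟨by omega⟩
  obtain ⟨f, hf⟩ := TypeB.exists_isPolygonLabelling (by omega) hc
  -- The action and the quotient map are surjections with the same kernel, so their targets are
  -- isomorphic.
  have hequiv := fun b => TypeB.exists_mulEquiv_of_ker_eq (TypeB.polygonAut hf)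
    (TypeB.dihedralQuotient b) (TypeB.polygonAut_surjective hf hn)
    (TypeB.dihedralQuotient_surjective b)
    ((TypeB.polygonAut_ker hf hn).trans (TypeB.dihedralQuotient_ker b).symm)
  refine ⟨TypeB.exists_isBipartition hf, ?_, ?_, ⟨f, hf⟩, fun f' hf' =>
    ⟨TypeB.polygonAut hf', TypeB.polygonAut_surjective hf' hn, TypeB.polygonAut_ker hf' hn,
      TypeB.sameBlock_polygonAut hf'⟩⟩
  · intro l r hlr
    obtain ⟨b, hl, hr⟩ := TypeB.eq_polygonHom_of_isBipartition hf hlr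
    have hl' : l⁻¹ = l := inv_eq_of_mul_eq_one_left (by rw [← pow_two, hlr.2.1])
    have hr' : r⁻¹ = r := inv_eq_of_mul_eq_one_left (by rw [← pow_two, hlr.2.2])
    -- The shift by `b` is chosen so that `sr b` and `sr (b + 1)` go to `sr 0` and `sr 1`.
    obtain ⟨e, he⟩ := hequiv b
    refine ⟨TypeB.polygonAut hf (.sr b), TypeB.polygonAut hf (.sr (b + 1)), fun w => ?_,
      fun w => ?_, ?_, e, ?_, ?_⟩
    · rw [TypeB.polygonAut_sr, ← hl, hl']
    · rw [TypeB.polygonAut_sr, ← hr, hr']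
    · rw [← Set.image_pair, ← MonoidHom.map_closure, TypeB.closure_sr_eq_top,
        ← MonoidHom.range_eq_map, MonoidHom.range_eq_top]
      exact TypeB.polygonAut_surjective hf hn
    · rw [he, TypeB.dihedralQuotient_sr, sub_self, map_zero]
    · rw [he, TypeB.dihedralQuotient_sr, add_sub_cancel_left, map_one]
  · obtain ⟨e, -⟩ := hequiv 0
    rw [Nat.card_congr e.toEquiv, DihedralGroup.nat_card]
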